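/- Let $\mathfrak M=\langle M,+,\cdot,-,0,1\rangle$ be a finite De Morgan algebra (a bounded distributive lattice, with join $+$, meet $\cdot$ and order $p\le q \iff p+q=q$, equipped with an operation $-$ such that $--p=p$, $-(p+q)=-p\cdot -q$ and $-(p\cdot q)=-p+-q$), and let $\alpha\ge\omega$ be an infinite ordinal. Throughout, $\sup A$ is only written for nonempty $A\subseteq M$. **$\mathfrak M$-cylindric algebras.** An $\mathfrak M$-cylindric algebra of dimension $\alpha$ ($\mathfrak M\text{-}\mathrm{CA}_\alpha$) is an algebra $\mathfrak A=\langle A,+,\cdot,-,u_p,c_\kappa,d_{\kappa\lambda},\delta_p\rangle_{\kappa,\lambda<\alpha,\,p\in M}$ with binary operations $+,\cdot$, unary operations $-,c_\kappa,\delta_p$ and distinguished elements $u_p,d_{\kappa\lambda}$, such that for all $a,b\in A$, $p,q\in M$ and $\kappa,\lambda,\mu<\alpha$: - $+$ and $\cdot$ are commutative and associative, each distributes over the other, $a+u_0=a$ and $a\cdot u_1=a$; $\delta_pa+-\delta_pa=u_1$ and $\delta_pa\cdot-\delta_pa=u_0$; - $c_\kappa u_0=u_0$; $a+c_\kappa a=c_\kappa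 a$; $c_\kappa(a\cdot c_\kappa b)=c_\kappa a\cdot c_\kappa b$; $c_\kappa c_\lambda a=c_\lambda c_\kappa a$; $d_{\kappa\kappa}=u_1$; $d_{\lambda\mu}=c_\kappa(d_{\lambda\kappa}\cdot d_{\kappa\mu})$ if $\kappa\ne\lambda,\mu$; $c_\kappa(d_{\kappa\lambda}\cdot\delta_1a)\cdot c_\kappa(d_{\kappa\lambda}\cdot-\delta_1a)=u_0$ if $\kappa\ne\lambda$; - $\delta_1(\delta_1a+\delta_1b)=\delta_1a+\delta_1b$; $\delta_1(\delta_1a\cdot\delta_1b)=\delta_1a\cdot\delta_1b$; $\delta_1(-\delta_1a)=-\delta_1a$; $\delta_1c_\kappa\delta_1a=c_\kappa\delta_1a$; $\delta_1d_{\kappa\lambda}=d_{\kappa\lambda}$; $\delta_0d_{\kappa\lambda}=-d_{\kappa\lambda}$; $\delta_pd_{\kappa\lambda}=u_0$ if $p\ne0,1$; - $\delta_p(-a)=\delta_{-p}a$; $\delta_pu_p=u_1$; $\delta_pu_q=u_0$ and $\delta_pa\cdot\delta_qa=u_0$ if $p\ne q$; $\sum_{p\in M}\delta_pa=u_1$;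 $\delta_p(a+b)=\sum_{q+r=p}\delta_qa\cdot\delta_rb$; $\delta_p(a\cdot b)=\sum_{q\cdot r=p}\delta_qa\cdot\delta_rb$; $\delta_1\delta_qa=\delta_qa$; $\delta_0\delta_qa=-\delta_qa$; $\delta_p\delta_qa=u_0$ if $p\ne0,1$; if $\delta_pa=\delta_pb$ for all $p\in M$, then $a=b$; - $\delta_pc_\kappa a=\Big(\sum_{\sup S=p}\ \prod_{q\in S}c_\kappa\delta_qa\Big)\cdot-\Big(\sum_{\sup S>p}\ \prod_{q\in S}c_\kappa\delta_qa\Big)$, the sums being over nonempty $S\subseteq M$ and an empty sum being $u_0$. The dimension set of $a\in A$ is $\dim_{\mathfrak A}a=\bigcup_{p\in M}\{\kappa<\alpha : c_\kappa\delta_pa\neq\delta_pa\}$; $\mathfrak A$ is locally finite if $\dim_{\mathfrak A}a$ is finite for every $a\in A$. **$\mathfrak M$-cylindric set algebras.** For a cylindric algebra $\mathfrak B=\langle B,+,\cdot,-,0,1,c_\kappa,d_{\kappa\lambda}\rangle$ of dimension $\alpha$, $\mathfrak M(\mathfrak B)$ is the algebra of all $x=(x^p)_{p\in M}\in B^M$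 with $x^p\cdot x^q=0$ for $p\neq q$ and $\sum_{p}x^p=1$, with operations $(x+y)^p=\sum_{q+r=p}x^q\cdot y^r$, $(x\cdot y)^p=\sum_{q\cdot r=p}x^q\cdot y^r$, $(-x)^p=x^{-p}$, $(c_\kappa x)^p=\big(\sum_{\sup S=p}\prod_{q\in S}c_\kappa x^q\big)\cdot-\big(\sum_{\sup S>p}\prod_{q\in S}c_\kappa x^q\big)$; $u_q$ has component $1$ at $q$ and $0$ elsewhere; $d_{\kappa\lambda}$ (respectively $\delta_qx$) has component $b$ at $1$, $-b$ at $0$ and $0$ elsewhere, where $b=d_{\kappa\lambda}$ (respectively $b=x^q$). (If $0=1$ in $M$, the component at $0=1$ is $b+-b=1$.) A cylindric set algebra of dimension $\alpha$ with base $U$ is a field of subsets of $U^\alpha$ that contains all $D_{\kappa\lambda}=\{s:s_\kappa=s_\lambda\}$ and is closed under $C_\kappa X=\{s : s\tbinom{\kappa}{x}\in X\text{ for some }x\in U\}$, where $s\tbinom{\kappa}{x}$ is $s$ with its $\kappa$-th entry replaced by $x$. An $\mathfrak M$-cylindric set algebra of dimension $\alpha$ ($\mathfrak M\text{-}\mathrm{CSA}_\alpha$)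 with base $U$ is a subalgebra $\mathfrak S$ of $\mathfrak M(\mathfrak B)$ for some cylindric set algebra $\mathfrak B$ of dimension $\alpha$ with base $U$. It is regular if for each of its members $L$, each $p\in M$ and all $s,t\in U^\alpha$ that agree on $\dim_{\mathfrak S}L$, one has $s\in L^p\iff t\in L^p$. An $\mathfrak M\text{-}\mathrm{CA}_\alpha$ is representable if it is isomorphic to a subdirect product of $\mathfrak M\text{-}\mathrm{CSA}_\alpha$'s. **Theorem (Representation Theorem).** Every locally finite $\mathfrak M\text{-}\mathrm{CA}_\alpha$ is isomorphic to a subalgebra of a product of regular $\mathfrak M\text{-}\mathrm{CSA}_\alpha$'s, and is representable. -/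

import Mathlib

universe u v w

/-! ### De Morgan algebras -/

/-- A De Morgan algebra: a bounded distributive lattice (`+` is `⊔`, `·` is `⊓`, `0` is `⊥`,
`1` is `⊤`) with an involution `-` satisfying the De Morgan laws. -/
class DeMorganAlgebra (M : Type*) extends DistribLattice M, BoundedOrder M, Neg M where
  neg_sup : ∀ x y : M, -(x ⊔ y) = -x ⊓ -y
  neg_inf : ∀ x y : M, -(x ⊓ y) = -x ⊔ -y
  neg_neg : ∀ x : M, -(-x) = x

section IndexSets

variable (M : Type w) [DeMorganAlgebra M] [Fintype M]

open Classical in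
/-- The pairs `(q, r)` with `q + r = p`. -/
noncomputable def supPairs (p : M) : Finset (M × M) :=
  Finset.univ.filter fun t => t.1 ⊔ t.2 = p

open Classical in
/-- The pairs `(q, r)` with `q · r = p`. -/
noncomputable def infPairs (p : M) : Finset (M × M) :=
  Finset.univ.filter fun t => t.1 ⊓ t.2 = p

open Classical in
/-- The nonempty `A ⊆ M` with `sup A = p`. -/
noncomputable def setsSupEq (p : M) : Finset (Finset M) :=
  Finset.univ.filter fun A => A.Nonempty ∧ A.sup id = p

open Classical in
/-- The nonempty `A ⊆ M` with `sup A > p`. -/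
noncomputable def setsSupGt (p : M) : Finset (Finset M) :=
  Finset.univ.filter fun A => A.Nonempty ∧ p < A.sup id

end IndexSets

/-! ### Algebras of the similarity type of `𝔐`-cylindric algebras -/

/-- An algebra with universe `A` of the similarity type of `𝔐`-cylindric algebras whose
dimension is (the order type of) `I`; no axioms are imposed. -/
structure MCylOps (M : Type*) (I : Type*) (A : Type*) where
  add : A → A → A
  mul : A → A → A
  neg : A → A
  u : M → A
  c : I → A → A
  d : I → I → A
  δ : M → A → A

namespace MCylOps

section Finitary

variable {M : Type*} [DeMorganAlgebra M] {I A : Type*} (𝔄 : MCylOps M I A) {ι : Type*}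

/-- The finite sum `∑_{i ∈ s} f i`, with the empty sum equal to `u₀`. As `+` is commutative and
associative with neutral element `u₀` wherever this is used, the enumeration of `s` is
immaterial. -/
noncomputable def sum (s : Finset ι) (f : ι → A) : A :=
  (s.toList.map f).foldr 𝔄.add (𝔄.u ⊥)

/-- The finite product `∏_{i ∈ s} f i`, with the empty product equal to `u₁`. -/
noncomputable def prod (s : Finset ι) (f : ι → A) : A :=
  (s.toList.map f).foldr 𝔄.mul (𝔄.u ⊤)

end Finitary

variable {M : Type*} {I A B : Type*}

/-- Homomorphisms: maps preserving all operations and all distinguished elements. -/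
structure IsHom (𝔄 : MCylOps M I A) (𝔅 : MCylOps M I B) (f : A → B) : Prop where
  map_add : ∀ a b, f (𝔄.add a b) = 𝔅.add (f a) (f b)
  map_mul : ∀ a b, f (𝔄.mul a b) = 𝔅.mul (f a) (f b)
  map_neg : ∀ a, f (𝔄.neg a) = 𝔅.neg (f a)
  map_u : ∀ p, f (𝔄.u p) = 𝔅.u p
  map_c : ∀ κ a, f (𝔄.c κ a) = 𝔅.c κ (f a)
  map_d : ∀ κ l, f (𝔄.d κ l) = 𝔅.d κ l
  map_δ : ∀ p a, f (𝔄.δ p a) = 𝔅.δ p (f a)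

/-- Subalgebras (given by their universes). -/
structure Subalgebra (𝔄 : MCylOps M I A) where
  carrier : Set A
  add_mem : ∀ {a b}, a ∈ carrier → b ∈ carrier → 𝔄.add a b ∈ carrier
  mul_mem : ∀ {a b}, a ∈ carrier → b ∈ carrier → 𝔄.mul a b ∈ carrier
  neg_mem : ∀ {a}, a ∈ carrier → 𝔄.neg a ∈ carrier
  u_mem : ∀ p, 𝔄.u p ∈ carrier
  c_mem : ∀ κ {a}, a ∈ carrier → 𝔄.c κ a ∈ carrier
  d_mem : ∀ κ l, 𝔄.d κ l ∈ carrier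
  δ_mem : ∀ p {a}, a ∈ carrier → 𝔄.δ p a ∈ carrier

/-- A subalgebra as an algebra in its own right, with the restricted operations. -/
def Subalgebra.ops {𝔄 : MCylOps M I A} (S : 𝔄.Subalgebra) : MCylOps M I S.carrier where
  add a b := ⟨𝔄.add a b, S.add_mem a.2 b.2⟩
  mul a b := ⟨𝔄.mul a b, S.mul_mem a.2 b.2⟩
  neg a := ⟨𝔄.neg a, S.neg_mem a.2⟩
  u p := ⟨𝔄.u p, S.u_mem p⟩
  c κ a := ⟨𝔄.c κ a, S.c_mem κ a.2⟩
  d κ l := ⟨𝔄.d κ l, S.d_mem κ l⟩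
  δ p a := ⟨𝔄.δ p a, S.δ_mem p a.2⟩

/-- The direct product of a family of algebras. -/
def pi {J : Type*} {D : J → Type*} (𝔇 : ∀ j, MCylOps M I (D j)) : MCylOps M I (∀ j, D j) where
  add a b j := (𝔇 j).add (a j) (b j)
  mul a b j := (𝔇 j).mul (a j) (b j)
  neg a j := (𝔇 j).neg (a j)
  u p j := (𝔇 j).u p
  c κ a j := (𝔇 j).c κ (a j)
  d κ l j := (𝔇 j).d κ l
  δ p a j := (𝔇 j).δ p (a j)

/-- The dimension set `⋃_{p ∈ M} {κ : c_κ δ_p a ≠ δ_p a}` of an element. -/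
def dim (𝔄 : MCylOps M I A) (a : A) : Set I :=
  ⋃ p : M, {κ | 𝔄.c κ (𝔄.δ p a) ≠ 𝔄.δ p a}

/-- Every element has a finite dimension set. -/
def IsLocallyFinite (𝔄 : MCylOps M I A) : Prop :=
  ∀ a, (𝔄.dim a).Finite

end MCylOps

/-! ### `𝔐`-cylindric algebras -/

/-- The axioms of `𝔐`-cylindric algebras. -/
structure IsMCylindricAlgebra {M I A : Type*} [DeMorganAlgebra M] [Fintype M]
    (𝔄 : MCylOps M I A) : Prop where
  add_comm : ∀ a b, 𝔄.add a b = 𝔄.add b a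
  mul_comm : ∀ a b, 𝔄.mul a b = 𝔄.mul b a
  add_assoc : ∀ a b c, 𝔄.add (𝔄.add a b) c = 𝔄.add a (𝔄.add b c)
  mul_assoc : ∀ a b c, 𝔄.mul (𝔄.mul a b) c = 𝔄.mul a (𝔄.mul b c)
  mul_add : ∀ a b c, 𝔄.mul a (𝔄.add b c) = 𝔄.add (𝔄.mul a b) (𝔄.mul a c)
  add_mul : ∀ a b c, 𝔄.add a (𝔄.mul b c) = 𝔄.mul (𝔄.add a b) (𝔄.add a c)
  add_u_zero : ∀ a, 𝔄.add a (𝔄.u ⊥) = a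
  mul_u_one : ∀ a, 𝔄.mul a (𝔄.u ⊤) = a
  δ_add_neg : ∀ p a, 𝔄.add (𝔄.δ p a) (𝔄.neg (𝔄.δ p a)) = 𝔄.u ⊤
  δ_mul_neg : ∀ p a, 𝔄.mul (𝔄.δ p a) (𝔄.neg (𝔄.δ p a)) = 𝔄.u ⊥
  c_u_zero : ∀ κ, 𝔄.c κ (𝔄.u ⊥) = 𝔄.u ⊥
  add_c : ∀ κ a, 𝔄.add a (𝔄.c κ a) = 𝔄.c κ a
  c_mul_c : ∀ κ a b, 𝔄.c κ (𝔄.mul a (𝔄.c κ b)) = 𝔄.mul (𝔄.c κ a) (𝔄.c κ b)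
  c_comm : ∀ κ l a, 𝔄.c κ (𝔄.c l a) = 𝔄.c l (𝔄.c κ a)
  d_eq_c : ∀ κ l m, κ ≠ l → κ ≠ m → 𝔄.d l m = 𝔄.c κ (𝔄.mul (𝔄.d l κ) (𝔄.d κ m))
  d_self : ∀ κ, 𝔄.d κ κ = 𝔄.u ⊤
  c_d_mul : ∀ κ l a, κ ≠ l →
    𝔄.mul (𝔄.c κ (𝔄.mul (𝔄.d κ l) (𝔄.δ ⊤ a)))
      (𝔄.c κ (𝔄.mul (𝔄.d κ l) (𝔄.neg (𝔄.δ ⊤ a)))) = 𝔄.u ⊥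
  δ_one_add : ∀ a b, 𝔄.δ ⊤ (𝔄.add (𝔄.δ ⊤ a) (𝔄.δ ⊤ b)) = 𝔄.add (𝔄.δ ⊤ a) (𝔄.δ ⊤ b)
  δ_one_mul : ∀ a b, 𝔄.δ ⊤ (𝔄.mul (𝔄.δ ⊤ a) (𝔄.δ ⊤ b)) = 𝔄.mul (𝔄.δ ⊤ a) (𝔄.δ ⊤ b)
  δ_one_neg : ∀ a, 𝔄.δ ⊤ (𝔄.neg (𝔄.δ ⊤ a)) = 𝔄.neg (𝔄.δ ⊤ a)
  δ_one_c : ∀ κ a, 𝔄.δ ⊤ (𝔄.c κ (𝔄.δ ⊤ a)) = 𝔄.c κ (𝔄.δ ⊤ a)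
  δ_one_d : ∀ κ l, 𝔄.δ ⊤ (𝔄.d κ l) = 𝔄.d κ l
  δ_zero_d : ∀ κ l, 𝔄.δ ⊥ (𝔄.d κ l) = 𝔄.neg (𝔄.d κ l)
  δ_d : ∀ p κ l, p ≠ ⊥ → p ≠ ⊤ → 𝔄.δ p (𝔄.d κ l) = 𝔄.u ⊥
  δ_neg : ∀ p a, 𝔄.δ p (𝔄.neg a) = 𝔄.δ (-p) a
  δ_u_self : ∀ p, 𝔄.δ p (𝔄.u p) = 𝔄.u ⊤
  δ_u_ne : ∀ p q, p ≠ q → 𝔄.δ p (𝔄.u q) = 𝔄.u ⊥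
  δ_mul_δ : ∀ p q a, p ≠ q → 𝔄.mul (𝔄.δ p a) (𝔄.δ q a) = 𝔄.u ⊥
  sum_δ : ∀ a, 𝔄.sum Finset.univ (fun p => 𝔄.δ p a) = 𝔄.u ⊤
  δ_add : ∀ p a b,
    𝔄.δ p (𝔄.add a b) = 𝔄.sum (supPairs M p) (fun t => 𝔄.mul (𝔄.δ t.1 a) (𝔄.δ t.2 b))
  δ_mul : ∀ p a b,
    𝔄.δ p (𝔄.mul a b) = 𝔄.sum (infPairs M p) (fun t => 𝔄.mul (𝔄.δ t.1 a) (𝔄.δ t.2 b))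
  δ_one_δ : ∀ q a, 𝔄.δ ⊤ (𝔄.δ q a) = 𝔄.δ q a
  δ_δ : ∀ p q a, p ≠ ⊥ → p ≠ ⊤ → 𝔄.δ p (𝔄.δ q a) = 𝔄.u ⊥
  δ_zero_δ : ∀ q a, 𝔄.δ ⊥ (𝔄.δ q a) = 𝔄.neg (𝔄.δ q a)
  ext : ∀ a b, (∀ p, 𝔄.δ p a = 𝔄.δ p b) → a = b
  δ_c : ∀ p κ a,
    𝔄.δ p (𝔄.c κ a) =
      𝔄.mul (𝔄.sum (setsSupEq M p) fun A => 𝔄.prod A fun q => 𝔄.c κ (𝔄.δ q a))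
        (𝔄.neg (𝔄.sum (setsSupGt M p) fun A => 𝔄.prod A fun q => 𝔄.c κ (𝔄.δ q a)))

/-! ### Cylindric algebras and cylindric set algebras -/

/-- A cylindric algebra of dimension `I` on the Boolean algebra `B`. -/
structure CylindricAlgebra (I : Type*) (B : Type*) [BooleanAlgebra B] where
  c : I → B → B
  d : I → I → B
  c_bot : ∀ κ, c κ ⊥ = ⊥
  le_c : ∀ κ x, x ≤ c κ x
  c_inf_c : ∀ κ x y, c κ (x ⊓ c κ y) = c κ x ⊓ c κ y
  c_comm : ∀ κ l x, c κ (c l x) = c l (c κ x)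
  d_self : ∀ κ, d κ κ = ⊤
  d_eq_c : ∀ κ l m, κ ≠ l → κ ≠ m → d l m = c κ (d l κ ⊓ d κ m)
  c_d_inf : ∀ κ l x, κ ≠ l → c κ (d κ l ⊓ x) ⊓ c κ (d κ l ⊓ xᶜ) = ⊥

open Classical in
/-- The cylindrification `C_κ X = {s : s(κ/x) ∈ X for some x ∈ U}`. -/
def cylindrify {I U : Type*} (κ : I) (X : Set (I → U)) : Set (I → U) :=
  {s | ∃ x : U, Function.update s κ x ∈ X}

/-- The diagonal `D_{κl} = {s : s_κ = s_l}`. -/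
def diagonal {I U : Type*} (κ l : I) : Set (I → U) :=
  {s | s κ = s l}

/-- A cylindric set algebra of dimension `I` with base `U`: a field of subsets of `U^I` that
contains the diagonals and is closed under cylindrifications. -/
structure CylindricSetAlgebra (I U : Type*) where
  sets : BooleanSubalgebra (Set (I → U))
  cylindrify_mem : ∀ κ {X}, X ∈ sets → cylindrify κ X ∈ sets
  diagonal_mem : ∀ κ l, diagonal κ l ∈ sets

/-- A cylindric set algebra is a cylindric algebra under its set operations. -/
def CylindricSetAlgebra.toCylindricAlgebra {I U : Type*} (𝔅 : CylindricSetAlgebra I U) :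
    CylindricAlgebra I 𝔅.sets where
  c κ X := ⟨cylindrify κ X.1, 𝔅.cylindrify_mem κ X.2⟩
  d κ l := ⟨diagonal κ l, 𝔅.diagonal_mem κ l⟩
  c_bot κ := by
    apply Subtype.ext
    ext s
    simp [cylindrify]
  le_c κ X := by
    intro s hs
    exact ⟨s κ, by simpa using hs⟩
  c_inf_c κ X Y := by
    apply Subtype.ext
    ext s
    simp [cylindrify]
  c_comm κ l X := by
    classical
    apply Subtype.ext
    ext s
    by_cases h : κ = l
    · subst h; rfl
    · simp only [cylindrify, Set.mem_ofPred_eq]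
      constructor
      · rintro ⟨x, y, hxy⟩
        refine ⟨y, x, ?_⟩
        rw [Function.update_comm h] at hxy
        convert hxy
      · rintro ⟨x, y, hxy⟩
        refine ⟨y, x, ?_⟩
        rw [Function.update_comm h]
        convert hxy
  d_self κ := by
    apply Subtype.ext
    ext s
    simp [diagonal]
  d_eq_c κ l m h₁ h₂ := by
    classical
    apply Subtype.ext
    ext s
    simp [diagonal, cylindrify, Function.update_of_ne h₁.symm, Function.update_of_ne h₂.symm]
  c_d_inf κ l X h := by
    classical
    apply Subtype.ext
    ext s
    simp only [cylindrify, diagonal, BooleanSubalgebra.val_inf, BooleanSubalgebra.val_compl,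
      BooleanSubalgebra.val_bot, Set.inf_eq_inter, Set.mem_inter_iff, Set.mem_ofPred_eq,
      Function.update_self, Function.update_of_ne h.symm, Set.mem_compl_iff, Set.bot_eq_empty,
      Set.mem_empty_iff_false, iff_false, not_and]
    rintro ⟨x, rfl, hx⟩ ⟨y, rfl, hy⟩
    exact hy hx

/-! ### The `𝔐`-cylindric algebra `𝔐(𝔅)` of a cylindric algebra `𝔅` -/

section MB

variable {M : Type*} [DeMorganAlgebra M] [Fintype M] {B : Type*} [BooleanAlgebra B]

/-- `x : M → B` has pairwise disjoint values that sum to `1`. -/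
def IsMPartition (x : M → B) : Prop :=
  (∀ p q, p ≠ q → x p ⊓ x q = ⊥) ∧ Finset.univ.sup x = ⊤

/-- `(x + y)^p = ∑_{q + r = p} x^q · y^r`. -/
noncomputable def mAdd (x y : M → B) (p : M) : B :=
  (supPairs M p).sup fun t => x t.1 ⊓ y t.2

/-- `(x · y)^p = ∑_{q · r = p} x^q · y^r`. -/
noncomputable def mMul (x y : M → B) (p : M) : B :=
  (infPairs M p).sup fun t => x t.1 ⊓ y t.2

open Classical in
/-- `u_q` has value `1` at `q` and `0` elsewhere. -/
noncomputable def mUnit (q p : M) : B :=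
  if p = q then ⊤ else ⊥

open Classical in
/-- The function with value `b` at `1`, value `-b` at `0`, and value `0` at all other `p`.
(Written as a sum so that it is still a partition of `1` when `0 = 1` in `M`.) -/
noncomputable def mTwoValued (b : B) (p : M) : B :=
  (if p = ⊤ then b else ⊥) ⊔ (if p = ⊥ then bᶜ else ⊥)

/-- `∑_{sup A = p} ∏_{q ∈ A} y^q · -∑_{sup A > p} ∏_{q ∈ A} y^q`. -/
noncomputable def mSup (y : M → B) (p : M) : B :=
  ((setsSupEq M p).sup fun A => A.inf y) ⊓ ((setsSupGt M p).sup fun A => A.inf y)ᶜ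


theorem mPartition_of_op {x y : M → B} (hx : IsMPartition x) (hy : IsMPartition y)
    (f : M × M → M) (S : M → Finset (M × M)) (hS : ∀ p t, t ∈ S p ↔ f t = p) :
    IsMPartition fun p => (S p).sup fun t => x t.1 ⊓ y t.2 := by
  constructor
  · intro p q hpq
    rw [← disjoint_iff, Finset.disjoint_sup_left]
    intro a ha
    rw [Finset.disjoint_sup_right]
    intro b hb
    rw [hS] at ha hb
    have hab : a.1 ≠ b.1 ∨ a.2 ≠ b.2 := by
      by_contra h
      push Not at h
      exact hpq (by rw [← ha, ← hb, Prod.ext h.1 h.2])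
    rcases hab with h | h
    · exact (disjoint_iff.2 (hx.1 _ _ h)).mono inf_le_left inf_le_left
    · exact (disjoint_iff.2 (hy.1 _ _ h)).mono inf_le_right inf_le_right
  · rw [eq_top_iff, ← inf_top_eq (⊤ : B)]
    nth_rw 1 [← hx.2]
    rw [← hy.2, Finset.sup_inf_sup]
    refine Finset.sup_le fun t _ => ?_
    refine le_trans ?_ (Finset.le_sup (Finset.mem_univ (f t)))
    exact Finset.le_sup (f := fun t : M × M => x t.1 ⊓ y t.2) ((hS _ _).2 rfl)

theorem mPartition_add {x y : M → B} (hx : IsMPartition x) (hy : IsMPartition y) :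
    IsMPartition (mAdd x y) :=
  mPartition_of_op hx hy (fun t => t.1 ⊔ t.2) (supPairs M) (by simp [supPairs])

theorem mPartition_mul {x y : M → B} (hx : IsMPartition x) (hy : IsMPartition y) :
    IsMPartition (mMul x y) :=
  mPartition_of_op hx hy (fun t => t.1 ⊓ t.2) (infPairs M) (by simp [infPairs])

theorem mPartition_neg {x : M → B} (hx : IsMPartition x) : IsMPartition fun p => x (-p) := by
  constructor
  · intro p q hpq
    refine hx.1 _ _ fun h => hpq ?_
    rw [← DeMorganAlgebra.neg_neg p, h, DeMorganAlgebra.neg_neg]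
  · rw [eq_top_iff, ← hx.2]
    refine Finset.sup_le fun p _ => ?_
    have h := Finset.le_sup (f := fun p => x (-p)) (Finset.mem_univ (-p))
    simpa only [DeMorganAlgebra.neg_neg] using h

theorem mPartition_unit (q : M) : IsMPartition (mUnit q : M → B) := by
  constructor
  · intro p r hpr
    unfold mUnit
    split_ifs with h₁ h₂
    · exact absurd (h₁.trans h₂.symm) hpr
    all_goals simp
  · rw [eq_top_iff]
    have h := Finset.le_sup (f := (mUnit q : M → B)) (Finset.mem_univ q)
    simpa [mUnit] using h

theorem mPartition_twoValued (b : B) : IsMPartition (mTwoValued b : M → B) := by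
  constructor
  · intro p q hpq
    by_cases h : (⊥ : M) = ⊤
    · have := subsingleton_of_bot_eq_top h
      exact absurd (Subsingleton.elim p q) hpq
    · unfold mTwoValued
      by_cases h₁ : p = ⊤ <;> by_cases h₂ : p = ⊥ <;> by_cases h₃ : q = ⊤ <;>
        by_cases h₄ : q = ⊥ <;> simp_all
  · rw [eq_top_iff, ← sup_compl_eq_top (x := b)]
    refine sup_le ?_ ?_
    · refine le_trans ?_ (Finset.le_sup (Finset.mem_univ (⊤ : M)))
      simp [mTwoValued]
    · refine le_trans ?_ (Finset.le_sup (Finset.mem_univ (⊥ : M)))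
      simp [mTwoValued]

theorem mPartition_sup {y : M → B} (hy : Finset.univ.sup y = ⊤) : IsMPartition (mSup y) := by
  classical
  constructor
  · have key : ∀ p q : M, ¬ q ≤ p → mSup y p ⊓ mSup y q = ⊥ := by
      intro p q hqp
      have h : ((setsSupEq M p).sup fun A => A.inf y) ⊓ ((setsSupEq M q).sup fun A => A.inf y) ≤
          (setsSupGt M p).sup fun A => A.inf y := by
        rw [Finset.sup_inf_sup]
        refine Finset.sup_le fun t ht => ?_
        simp only [Finset.mem_product, setsSupEq, Finset.mem_filter, Finset.mem_univ,
          true_and] at ht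
        rw [← Finset.inf_union]
        refine Finset.le_sup (f := fun A : Finset M => A.inf y) ?_
        simp only [setsSupGt, Finset.mem_filter, Finset.mem_univ, true_and, Finset.sup_union,
          ht.1.2, ht.2.2]
        refine ⟨ht.1.1.mono Finset.subset_union_left, lt_of_le_of_ne le_sup_left fun h => hqp ?_⟩
        rw [h]
        exact le_sup_right
      unfold mSup
      rw [← le_bot_iff]
      calc _ ≤ (((setsSupEq M p).sup fun A => A.inf y) ⊓ ((setsSupEq M q).sup fun A => A.inf y)) ⊓
              ((setsSupGt M p).sup fun A => A.inf y)ᶜ :=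
            le_inf (inf_le_inf inf_le_left inf_le_left) (inf_le_left.trans inf_le_right)
        _ ≤ _ := (inf_le_inf_right _ h).trans_eq (inf_compl_eq_bot)
    intro p q hpq
    by_cases h : q ≤ p
    · rw [inf_comm]
      exact key q p fun h' => hpq (le_antisymm h' h)
    · exact key p q h
  · have key : ∀ p : M, ((setsSupEq M p).sup fun A => A.inf y) ≤ Finset.univ.sup (mSup y) := by
      intro p
      induction p using (wellFounded_gt (α := M)).induction with
      | _ p ih =>
        have h : ((setsSupGt M p).sup fun A => A.inf y) ≤ Finset.univ.sup (mSup y) := by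
          refine Finset.sup_le fun A hA => ?_
          simp only [setsSupGt, Finset.mem_filter, Finset.mem_univ, true_and] at hA
          refine le_trans ?_ (ih (A.sup id) hA.2)
          refine Finset.le_sup (f := fun A : Finset M => A.inf y) ?_
          simp [setsSupEq, hA.1]
        refine le_trans ?_ (sup_le h (Finset.le_sup (f := mSup y) (Finset.mem_univ p)))
        unfold mSup
        rw [sup_inf_left, sup_compl_eq_top, inf_top_eq]
        exact le_sup_right
    rw [eq_top_iff, ← hy]
    refine Finset.sup_le fun p _ => le_trans ?_ (key p)
    have h := Finset.le_sup (s := setsSupEq M p) (f := fun A : Finset M => A.inf y) (b := {p})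
      (by simp [setsSupEq])
    simpa using h

variable (M) in
/-- The universe of `𝔐(𝔅)`. -/
abbrev MPartition (B : Type*) [BooleanAlgebra B] := {x : M → B // IsMPartition x}

variable (M) in
/-- The algebra `𝔐(𝔅)`. -/
noncomputable def CylindricAlgebra.toM {I : Type*} (𝔅 : CylindricAlgebra I B) :
    MCylOps M I (MPartition M B) where
  add x y := ⟨mAdd x.1 y.1, mPartition_add x.2 y.2⟩
  mul x y := ⟨mMul x.1 y.1, mPartition_mul x.2 y.2⟩
  neg x := ⟨fun p => x.1 (-p), mPartition_neg x.2⟩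
  u q := ⟨mUnit q, mPartition_unit q⟩
  c κ x := ⟨mSup fun q => 𝔅.c κ (x.1 q), mPartition_sup (by
    rw [eq_top_iff, ← x.2.2]
    exact Finset.sup_mono_fun fun q _ => 𝔅.le_c κ (x.1 q))⟩
  d κ l := ⟨mTwoValued (𝔅.d κ l), mPartition_twoValued _⟩
  δ q x := ⟨mTwoValued (x.1 q), mPartition_twoValued _⟩

end MB

/-! ### `𝔐`-cylindric set algebras and representability -/

/-- An `𝔐`-cylindric set algebra of dimension `I` with base `U`: a subalgebra of `𝔐(𝔅)` for some
cylindric set algebra `𝔅` of dimension `I` with base `U`. -/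
structure MCylindricSetAlgebra (M : Type*) [DeMorganAlgebra M] [Fintype M] (I U : Type*) where
  base : CylindricSetAlgebra I U
  sub : (base.toCylindricAlgebra.toM M).Subalgebra

namespace MCylindricSetAlgebra

variable {M : Type*} [DeMorganAlgebra M] [Fintype M] {I U : Type*}

/-- The universe of an `𝔐`-cylindric set algebra. -/
abbrev Elem (𝔖 : MCylindricSetAlgebra M I U) : Type _ := 𝔖.sub.carrier

/-- The operations of an `𝔐`-cylindric set algebra. -/
noncomputable def ops (𝔖 : MCylindricSetAlgebra M I U) : MCylOps M I 𝔖.Elem := 𝔖.sub.ops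

/-- The component `L^p ⊆ U^I` of an element `L`. -/
def component {𝔖 : MCylindricSetAlgebra M I U} (L : 𝔖.Elem) (p : M) : Set (I → U) :=
  (L.1.1 p).1

end MCylindricSetAlgebra

/-- `X ⊆ U^I` depends on `Γ ⊆ I`: membership of `s` in `X` is determined by the restriction of
`s` to `Γ`. -/
def SetDependsOn {I U : Type*} (Γ : Set I) (X : Set (I → U)) : Prop :=
  ∀ s t : I → U, (∀ κ ∈ Γ, s κ = t κ) → (s ∈ X ↔ t ∈ X)

/-- Every member depends on its dimension set. -/
def MCylindricSetAlgebra.IsRegular {M : Type*} [DeMorganAlgebra M] [Fintype M] {I U : Type*}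
    (𝔖 : MCylindricSetAlgebra M I U) : Prop :=
  ∀ (L : 𝔖.Elem) (p : M), SetDependsOn (𝔖.ops.dim L) (component L p)

namespace MCylOps

variable {M : Type w} {I : Type v} {A : Type u}

/-- `𝔄` and `𝔅` are isomorphic. -/
def IsIsomorphic {B : Type*} (𝔄 : MCylOps M I A) (𝔅 : MCylOps M I B) : Prop :=
  ∃ f : A ≃ B, IsHom 𝔄 𝔅 f

/-- A subalgebra of a direct product is subdirect if all its projections are onto. -/
def Subalgebra.IsSubdirect {J : Type*} {D : J → Type*} {𝔇 : ∀ j, MCylOps M I (D j)}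
    (S : (pi 𝔇).Subalgebra) : Prop :=
  ∀ j, ∀ b : D j, ∃ a ∈ S.carrier, a j = b

/-- `𝔄` is isomorphic to a subalgebra of a product of regular `𝔐`-cylindric set algebras. -/
def IsRegularlyRepresentable [DeMorganAlgebra M] [Fintype M] (𝔄 : MCylOps M I A) : Prop :=
  ∃ (J : Type (max u v)) (U : J → Type (max u v)) (𝔖 : ∀ j, MCylindricSetAlgebra M I (U j)),
    (∀ j, (𝔖 j).IsRegular) ∧
      ∃ S : (pi fun j => (𝔖 j).ops).Subalgebra, 𝔄.IsIsomorphic S.ops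

/-- `𝔄` is representable: it is isomorphic to a subdirect product of `𝔐`-cylindric set
algebras. -/
def IsRepresentable [DeMorganAlgebra M] [Fintype M] (𝔄 : MCylOps M I A) : Prop :=
  ∃ (J : Type (max u v)) (U : J → Type (max u v)) (𝔖 : ∀ j, MCylindricSetAlgebra M I (U j)),
    ∃ S : (pi fun j => (𝔖 j).ops).Subalgebra, S.IsSubdirect ∧ 𝔄.IsIsomorphic S.ops

end MCylOps

/-! Call an element crisp if `δ ⊤ a = a`. The crisp elements form an ordinary cylindric algebra
`h.crisp`, and the axioms on `δ` make `a ↦ (δ_p a)_p` an embedding of `𝔄` into `𝔐(h.crisp)`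
(`isHom_toMPartition`, `component_injective`). As `𝔐(·)` is functorial (`isHom_mapMPartition`), it
suffices to separate nonzero crisp elements from `⊥` by homomorphisms into full set algebras. This
is the classical representation theorem for locally finite cylindric algebras of infinite dimension,
`IsLocallyFinite.exists_isHom_full`.

That theorem is a Henkin completeness proof. Elements of `B` are formulas, dimensions are variables,
and an injective sequence `φ` of variables supplies constants naming the points of `ℕ`. An
ultrafilter `χ` is a complete theory; `x` holds at `s` if `χ` accepts `x` with each `κ` replaced by
`φ (s κ)`. Two obstacles arise. The variable `φ (s κ)` may itself occur in `x`, so it is first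
exchanged for a `χ`-equal `φ m` that does not; `χ` is built so that every such class is infinite.
Also `B` may be uncountable, while the Rasiowa–Sikorski lemma meets only countably many dense sets;
hence each pre-model is made to respect finitely many cylindrifications, and an ultraproduct over
the finite sets of cylindrifications respects them all.

Regularity needs one more argument, since a homomorphism may shrink dimension sets: a set with
finite support does not depend on any coordinate whose cylindrification fixes it
(`SetDependsOn.of_cylindrify_eq`). -/

namespace CylindricAlgebra

/-! ### Arithmetic of cylindric algebras and substitutions. -/

section Basic

variable {I : Type v} {B : Type u} [BooleanAlgebra B] (𝔅 : CylindricAlgebra I B)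

theorem c_top (κ : I) : 𝔅.c κ ⊤ = ⊤ := top_le_iff.1 (𝔅.le_c κ ⊤)

theorem c_c (κ : I) (x : B) : 𝔅.c κ (𝔅.c κ x) = 𝔅.c κ x := by
  simpa [c_top] using 𝔅.c_inf_c κ ⊤ x

theorem c_mono (κ : I) {x y : B} (h : x ≤ y) : 𝔅.c κ x ≤ 𝔅.c κ y := by
  have := 𝔅.c_inf_c κ x y
  rw [inf_eq_left.2 (h.trans (𝔅.le_c κ y))] at this
  exact left_eq_inf.1 this

theorem c_compl_c (κ : I) (x : B) : 𝔅.c κ (𝔅.c κ x)ᶜ = (𝔅.c κ x)ᶜ := by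
  refine le_antisymm ?_ (𝔅.le_c _ _)
  rw [le_compl_iff_disjoint_right, disjoint_iff, ← 𝔅.c_inf_c, compl_inf_eq_bot, 𝔅.c_bot]

theorem c_compl {κ : I} {x : B} (h : 𝔅.c κ x = x) : 𝔅.c κ xᶜ = xᶜ := by
  have := 𝔅.c_compl_c κ x
  rwa [h] at this

theorem c_inf {κ : I} {x y : B} (hx : 𝔅.c κ x = x) (hy : 𝔅.c κ y = y) :
    𝔅.c κ (x ⊓ y) = x ⊓ y := by
  have := 𝔅.c_inf_c κ x y
  rwa [hx, hy] at this

theorem c_inf_left {κ : I} {x : B} (hx : 𝔅.c κ x = x) (y : B) :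
    𝔅.c κ (x ⊓ y) = x ⊓ 𝔅.c κ y := by
  have := 𝔅.c_inf_c κ y x
  rwa [hx, inf_comm, inf_comm (𝔅.c κ y)] at this

theorem c_sup (κ : I) (x y : B) : 𝔅.c κ (x ⊔ y) = 𝔅.c κ x ⊔ 𝔅.c κ y := by
  apply le_antisymm
  · have h : 𝔅.c κ (𝔅.c κ x ⊔ 𝔅.c κ y) = 𝔅.c κ x ⊔ 𝔅.c κ y := by
      have := 𝔅.c_compl (𝔅.c_inf (𝔅.c_compl_c κ x) (𝔅.c_compl_c κ y))
      simpa only [compl_inf, compl_compl] using this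
    rw [← h]
    exact 𝔅.c_mono κ (sup_le_sup (𝔅.le_c κ x) (𝔅.le_c κ y))
  · exact sup_le (𝔅.c_mono κ le_sup_left) (𝔅.c_mono κ le_sup_right)

theorem c_d {κ l : I} (h : κ ≠ l) : 𝔅.c κ (𝔅.d κ l) = ⊤ := by
  rw [eq_top_iff, ← 𝔅.d_self l, 𝔅.d_eq_c κ l l h h]
  exact 𝔅.c_mono κ inf_le_right

/-- Here `c κ (d κ l ⊓ d l κ) = d l l = ⊤`, so the axiom `c_d_inf` forces `c κ (d κ l ⊓ (d l κ)ᶜ)`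
to vanish. -/
theorem d_le_symm (κ l : I) : 𝔅.d κ l ≤ 𝔅.d l κ := by
  rcases eq_or_ne κ l with rfl | h
  · exact le_rfl
  · have h₁ := 𝔅.c_d_inf κ l (𝔅.d l κ) h
    rw [inf_comm (𝔅.d κ l), ← 𝔅.d_eq_c κ l l h h, 𝔅.d_self, top_inf_eq] at h₁
    have h₂ := (𝔅.le_c κ (𝔅.d κ l ⊓ (𝔅.d l κ)ᶜ)).trans_eq h₁
    rwa [le_bot_iff, ← disjoint_iff, disjoint_compl_right_iff] at h₂

theorem d_symm (κ l : I) : 𝔅.d κ l = 𝔅.d l κ :=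
  le_antisymm (𝔅.d_le_symm κ l) (𝔅.d_le_symm l κ)

theorem c_d_of_ne {κ l m : I} (hl : κ ≠ l) (hm : κ ≠ m) : 𝔅.c κ (𝔅.d l m) = 𝔅.d l m := by
  rw [𝔅.d_eq_c κ l m hl hm, c_c]

theorem d_trans (l κ m : I) : 𝔅.d l κ ⊓ 𝔅.d κ m ≤ 𝔅.d l m := by
  rcases eq_or_ne κ l with rfl | hl
  · exact inf_le_right
  · rcases eq_or_ne κ m with rfl | hm
    · exact inf_le_left
    · rw [𝔅.d_eq_c κ l m hl hm]
      exact 𝔅.le_c _ _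

/-- The substitution operation `s^κ_l`. -/
def subst (κ l : I) (x : B) : B := 𝔅.c κ (𝔅.d κ l ⊓ x)

theorem subst_le_c (κ l : I) (x : B) : 𝔅.subst κ l x ≤ 𝔅.c κ x := 𝔅.c_mono κ inf_le_right

/-- The substitutions of `x` and `xᶜ` are disjoint by `c_d_inf` and join to `c κ (d κ l) = ⊤`.
Together with additivity this makes `subst κ l` a Boolean endomorphism. -/
theorem subst_compl {κ l : I} (h : κ ≠ l) (x : B) : 𝔅.subst κ l xᶜ = (𝔅.subst κ l x)ᶜ := by
  refine (IsCompl.of_eq ?_ ?_).compl_eq.symm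
  · exact 𝔅.c_d_inf κ l x h
  · rw [subst, subst, ← c_sup, ← inf_sup_left, sup_compl_eq_top, inf_top_eq, 𝔅.c_d h]

theorem subst_sup (κ l : I) (x y : B) :
    𝔅.subst κ l (x ⊔ y) = 𝔅.subst κ l x ⊔ 𝔅.subst κ l y := by
  rw [subst, inf_sup_left, c_sup]
  rfl

theorem subst_inf {κ l : I} (h : κ ≠ l) (x y : B) :
    𝔅.subst κ l (x ⊓ y) = 𝔅.subst κ l x ⊓ 𝔅.subst κ l y := by
  rw [← compl_inj_iff, ← 𝔅.subst_compl h, compl_inf, compl_inf, subst_sup, 𝔅.subst_compl h,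
    𝔅.subst_compl h]

theorem subst_of_c_eq {κ l : I} (h : κ ≠ l) {x : B} (hx : 𝔅.c κ x = x) : 𝔅.subst κ l x = x := by
  rw [subst, inf_comm, 𝔅.c_inf_left hx, 𝔅.c_d h, inf_top_eq]

theorem c_subst_comm {κ l m : I} (hκ : m ≠ κ) (hl : m ≠ l) (x : B) :
    𝔅.c m (𝔅.subst κ l x) = 𝔅.subst κ l (𝔅.c m x) := by
  rw [subst, 𝔅.c_comm, 𝔅.c_inf_left (𝔅.c_d_of_ne hκ hl)]
  rfl

theorem subst_comm {κ l κ' l' : I} (h₁ : κ ≠ κ') (h₂ : κ ≠ l') (h₃ : κ' ≠ l) (x : B) :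
    𝔅.subst κ l (𝔅.subst κ' l' x) = 𝔅.subst κ' l' (𝔅.subst κ l x) := by
  unfold subst
  rw [← 𝔅.c_inf_left (𝔅.c_d_of_ne h₁.symm h₃), ← 𝔅.c_inf_left (𝔅.c_d_of_ne h₁ h₂), 𝔅.c_comm,
    inf_left_comm]

/-- The factor `d l m` does not depend on `κ`, so it moves under `c κ`, where it combines with `d κ
l` to give `d κ m`. -/
theorem subst_inf_d_le {κ l m : I} (hl : κ ≠ l) (hm : κ ≠ m) (x : B) :
    𝔅.subst κ l x ⊓ 𝔅.d l m ≤ 𝔅.subst κ m x := by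
  unfold subst
  rw [inf_comm, ← 𝔅.c_inf_left (𝔅.c_d_of_ne hl hm)]
  refine 𝔅.c_mono κ (le_inf ?_ (inf_le_right.trans inf_le_right))
  refine le_trans (le_inf ?_ inf_le_left) (𝔅.d_trans κ l m)
  exact inf_le_right.trans inf_le_left

/-- Renaming of a bound variable: `l` is fresh for `x`. -/
theorem c_subst_of_c_eq {κ l : I} (h : κ ≠ l) {x : B} (hx : 𝔅.c l x = x) :
    𝔅.c l (𝔅.subst κ l x) = 𝔅.c κ x := by
  rw [subst, 𝔅.c_comm, inf_comm, 𝔅.c_inf_left hx, 𝔅.d_symm, 𝔅.c_d h.symm, inf_top_eq]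

theorem subst_d {κ l m : I} (hl : κ ≠ l) (hm : κ ≠ m) : 𝔅.subst κ l (𝔅.d κ m) = 𝔅.d l m := by
  rw [subst, 𝔅.d_symm κ l, ← 𝔅.d_eq_c κ l m hl hm]

theorem subst_d_right {κ l m : I} (hl : κ ≠ l) (hm : κ ≠ m) :
    𝔅.subst κ l (𝔅.d m κ) = 𝔅.d m l := by
  rw [𝔅.d_symm m κ, 𝔅.subst_d hl hm, 𝔅.d_symm]

/-- The composition of the substitutions `s^κ_{f κ}` with `κ ∈ D`; the order is immaterial if `f`
maps `D` into its complement. -/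
noncomputable def substs (D : Finset I) (f : I → I) (x : B) : B :=
  D.toList.foldr (fun κ y => 𝔅.subst κ (f κ) y) x

@[simp]
theorem substs_empty (f : I → I) (x : B) : 𝔅.substs ∅ f x = x := by
  simp [substs]

theorem substs_congr {D : Finset I} {f g : I → I} (h : ∀ κ ∈ D, f κ = g κ) (x : B) :
    𝔅.substs D f x = 𝔅.substs D g x := by
  unfold substs
  have h' : ∀ κ ∈ D.toList, f κ = g κ := fun κ hκ => h κ (Finset.mem_toList.1 hκ)
  generalize D.toList = L at h'
  induction L with
  | nil => rfl
  | cons κ L ih =>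
    simp only [List.mem_cons, forall_eq_or_imp] at h'
    simp only [List.foldr_cons, ih h'.2, h'.1]

-- The list underlying `insert κ D` is only a permutation of `κ :: D.toList`; since no target lies
-- in `insert κ D`, the single substitutions commute.
open Classical in
theorem substs_insert {D : Finset I} {κ : I} (hκ : κ ∉ D) {f : I → I}
    (hf : ∀ m ∈ insert κ D, f m ∉ insert κ D) (x : B) :
    𝔅.substs (insert κ D) f x = 𝔅.subst κ (f κ) (𝔅.substs D f x) := by
  have hp : (insert κ D).toList.Perm (κ :: D.toList) := Finset.toList_insert hκ
  unfold substs
  rw [hp.foldr_eq']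
  · rfl
  · intro a ha b hb z
    rw [Finset.mem_toList] at ha hb
    rcases eq_or_ne a b with rfl | hab
    · rfl
    · refine 𝔅.subst_comm hab.symm ?_ ?_ z
      · rintro rfl
        exact hf _ ha hb
      · rintro rfl
        exact hf _ hb ha

theorem substs_compl {D : Finset I} {f : I → I} (hf : ∀ m ∈ D, f m ∉ D) (x : B) :
    𝔅.substs D f xᶜ = (𝔅.substs D f x)ᶜ := by
  classical
  induction D using Finset.induction_on with
  | empty => simp
  | insert κ D hκ ih =>
    have h : ∀ m ∈ D, f m ∉ D := fun m hm h => hf m (by simp [hm]) (by simp [h])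
    rw [𝔅.substs_insert hκ hf, 𝔅.substs_insert hκ hf, ih h, 𝔅.subst_compl]
    intro h
    exact hf κ (by simp) (by simp [← h])

theorem substs_inf {D : Finset I} {f : I → I} (hf : ∀ m ∈ D, f m ∉ D) (x y : B) :
    𝔅.substs D f (x ⊓ y) = 𝔅.substs D f x ⊓ 𝔅.substs D f y := by
  classical
  induction D using Finset.induction_on with
  | empty => simp
  | insert κ D hκ ih =>
    have h : ∀ m ∈ D, f m ∉ D := fun m hm h => hf m (by simp [hm]) (by simp [h])
    rw [𝔅.substs_insert hκ hf, 𝔅.substs_insert hκ hf, 𝔅.substs_insert hκ hf, ih h, 𝔅.subst_inf]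
    intro h
    exact hf κ (by simp) (by simp [← h])

theorem c_substs_comm {D : Finset I} {f : I → I} (hf : ∀ m ∈ D, f m ∉ D) {κ : I} (hκ : κ ∉ D)
    (hκf : ∀ m ∈ D, κ ≠ f m) (x : B) :
    𝔅.c κ (𝔅.substs D f x) = 𝔅.substs D f (𝔅.c κ x) := by
  classical
  induction D using Finset.induction_on with
  | empty => simp
  | insert l D hl ih =>
    have h : ∀ m ∈ D, f m ∉ D := fun m hm h => hf m (by simp [hm]) (by simp [h])
    simp only [Finset.mem_insert, not_or] at hκ
    rw [𝔅.substs_insert hl hf, 𝔅.substs_insert hl hf, 𝔅.c_subst_comm hκ.1 (hκf l (by simp)),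
      ih h hκ.2 fun m hm => hκf m (by simp [hm])]

theorem subst_substs_comm {D : Finset I} {f : I → I} (hf : ∀ m ∈ D, f m ∉ D) {κ l : I}
    (hκ : κ ∉ D) (hl : l ∉ D) (hκf : ∀ m ∈ D, κ ≠ f m) (x : B) :
    𝔅.subst κ l (𝔅.substs D f x) = 𝔅.substs D f (𝔅.subst κ l x) := by
  classical
  induction D using Finset.induction_on with
  | empty => simp
  | insert n D hn ih =>
    have h : ∀ m ∈ D, f m ∉ D := fun m hm h => hf m (by simp [hm]) (by simp [h])
    simp only [Finset.mem_insert, not_or] at hκ hl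
    rw [𝔅.substs_insert hn hf, 𝔅.substs_insert hn hf,
      𝔅.subst_comm hκ.1 (hκf n (by simp)) (Ne.symm hl.1),
      ih h hκ.2 hl.2 fun m hm => hκf m (by simp [hm])]

-- A substitution for a coordinate on which `x` does not depend is moved innermost, where it acts
-- trivially.
open Classical in
theorem substs_union {D E : Finset I} {f : I → I} (hf : ∀ m ∈ D ∪ E, f m ∉ D ∪ E) {x : B}
    (hx : ∀ κ ∈ E, 𝔅.c κ x = x) : 𝔅.substs (D ∪ E) f x = 𝔅.substs D f x := by
  induction E using Finset.induction_on with
  | empty => simp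
  | insert κ E hκ ih =>
    have hf' : ∀ m ∈ D ∪ E, f m ∉ D ∪ E := fun m hm h =>
      hf m (by rw [Finset.union_insert]; exact Finset.mem_insert_of_mem hm)
        (by rw [Finset.union_insert]; exact Finset.mem_insert_of_mem h)
    have ih' := ih hf' fun m hm => hx m (Finset.mem_insert_of_mem hm)
    rw [Finset.union_insert] at hf ⊢
    by_cases hD : κ ∈ D ∪ E
    · rw [Finset.insert_eq_of_mem hD, ih']
    · have h₁ : ∀ m ∈ D ∪ E, κ ≠ f m := by
        rintro m hm rfl
        exact hf m (by simp [hm]) (by simp)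
      have h₂ : f κ ∉ insert κ (D ∪ E) := hf κ (by simp)
      rw [Finset.mem_insert, not_or] at h₂
      rw [𝔅.substs_insert hD hf, 𝔅.subst_substs_comm hf' hD h₂.2 h₁,
        𝔅.subst_of_c_eq (Ne.symm h₂.1) (hx κ (by simp)), ih']

/-- A Boolean homomorphism to the two-element algebra does not distinguish substitutions that it
takes to be equal. -/
theorem substs_iff_of_d (χ : BoundedLatticeHom B Prop) {D : Finset I} {f g : I → I}
    (hf : ∀ m ∈ D, f m ∉ D) (hg : ∀ m ∈ D, g m ∉ D) (h : ∀ m ∈ D, χ (𝔅.d (f m) (g m))) (x : B) :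
    χ (𝔅.substs D f x) ↔ χ (𝔅.substs D g x) := by
  classical
  induction D using Finset.induction_on generalizing x with
  | empty => simp
  | insert κ D hκ ih =>
    have hf' : ∀ m ∈ D, f m ∉ D := fun m hm h => hf m (by simp [hm]) (by simp [h])
    have hg' : ∀ m ∈ D, g m ∉ D := fun m hm h => hg m (by simp [hm]) (by simp [h])
    have hfκ := hf κ (by simp)
    have hgκ := hg κ (by simp)
    rw [Finset.mem_insert, not_or] at hfκ hgκ
    have hκf : ∀ m ∈ D, κ ≠ f m := by
      rintro m hm rfl
      exact hf m (by simp [hm]) (by simp)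
    have hκg : ∀ m ∈ D, κ ≠ g m := by
      rintro m hm rfl
      exact hg m (by simp [hm]) (by simp)
    have hd := h κ (by simp)
    have hχ : ∀ a b c : B, a ⊓ b ≤ c → χ b → χ a → χ c := fun a b c hab hb ha => by
      have h₁ := OrderHomClass.mono χ hab
      rw [map_inf] at h₁
      exact h₁ ⟨ha, hb⟩
    -- The substitution for `κ` goes innermost so that the induction hypothesis replaces `g` by `f`
    -- on `D`, then outermost again. Both sides now differ only in the target of `κ`.
    rw [𝔅.substs_insert hκ hf, 𝔅.substs_insert hκ hg, 𝔅.subst_substs_comm hg' hκ hgκ.2 hκg,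
      ← ih hf' hg' (fun m hm => h m (by simp [hm])), ← 𝔅.subst_substs_comm hf' hκ hgκ.2 hκf]
    constructor
    · exact hχ _ _ _ (𝔅.subst_inf_d_le (Ne.symm hfκ.1) (Ne.symm hgκ.1) _) hd
    · refine hχ _ _ _ (𝔅.subst_inf_d_le (Ne.symm hgκ.1) (Ne.symm hfκ.1) _) ?_
      rwa [𝔅.d_symm]

end Basic

end CylindricAlgebra

/-! ### Ultrafilters and generic filters. -/

/-- The two-valued homomorphism given by a prime ideal. -/
theorem Order.Ideal.IsPrime.exists_boundedLatticeHom {B : Type*} [BooleanAlgebra B]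
    {J : Order.Ideal B} (hJ : J.IsPrime) :
    ∃ χ : BoundedLatticeHom B Prop, ∀ x, χ x ↔ x ∉ J := by
  refine ⟨{ toFun := fun x => x ∉ J, map_sup' := ?_, map_inf' := ?_, map_top' := ?_,
            map_bot' := ?_ }, fun x => Iff.rfl⟩
  · intro x y
    refine propext ?_
    rw [Order.Ideal.sup_mem_iff, not_and_or]
    rfl
  · intro x y
    refine propext ?_
    have h : x ⊓ y ∈ J ↔ x ∈ J ∨ y ∈ J :=
      ⟨hJ.mem_or_mem, fun h => h.elim (J.lower inf_le_left) (J.lower inf_le_right)⟩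
    rw [h, not_or]
    rfl
  · exact eq_true hJ.toIsProper.top_notMem
  · exact eq_false (not_not.2 J.bot_mem)

/-- The Rasiowa–Sikorski lemma: below a nonzero element there is an ultrafilter meeting countably
many dense sets. -/
theorem exists_boundedLatticeHom_of_dense {B : Type*} [BooleanAlgebra B] {ι : Type*} [Countable ι]
    (𝒟 : ι → Set B) (h𝒟 : ∀ i, ∀ b : B, b ≠ ⊥ → ∃ a ∈ 𝒟 i, a ≠ ⊥ ∧ a ≤ b) {b : B} (hb : b ≠ ⊥) :
    ∃ χ : BoundedLatticeHom B Prop, χ b ∧ ∀ i, ∃ a ∈ 𝒟 i, χ a := by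
  have := Encodable.ofCountable ι
  -- In the reversed order on nonzero elements, dense sets are cofinal, and a generic ideal
  -- generates a proper filter.
  let P := {b : B // b ≠ ⊥}ᵒᵈ
  let 𝒞 : ι → Order.Cofinal P := fun i =>
    { carrier := {a | (OrderDual.ofDual a).1 ∈ 𝒟 i}
      isCofinal := fun b => by
        obtain ⟨a, ha, ha₀, hab⟩ := h𝒟 i (OrderDual.ofDual b).1 (OrderDual.ofDual b).2
        exact ⟨OrderDual.toDual ⟨a, ha₀⟩, ha, hab⟩ }
  let p : P := OrderDual.toDual ⟨b, hb⟩
  let G := Order.idealOfCofinals p 𝒞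
  have hF : Order.IsPFilter {y : B | ∃ a : P, a ∈ G ∧ (OrderDual.ofDual a).1 ≤ y} := by
    refine Order.IsPFilter.of_def ?_ ?_ ?_
    · exact ⟨b, p, Order.mem_idealOfCofinals p 𝒞, le_rfl⟩
    · rintro x ⟨a, ha, hax⟩ y ⟨a', ha', hay⟩
      obtain ⟨e, he, hae, hae'⟩ := G.directed a ha a' ha'
      exact ⟨(OrderDual.ofDual e).1, ⟨e, he, le_rfl⟩, le_trans hae hax, le_trans hae' hay⟩
    · rintro x y hxy ⟨a, ha, hax⟩
      exact ⟨a, ha, hax.trans hxy⟩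
  obtain ⟨J, hJ, -, hFJ⟩ := DistribLattice.prime_ideal_of_disjoint_filter_ideal
    (F := hF.toPFilter) (I := Order.Ideal.principal (⊥ : B)) (by
      rw [Set.disjoint_left]
      rintro y ⟨a, -, hay⟩ hy
      exact (OrderDual.ofDual a).2 (le_bot_iff.1 (hay.trans hy)))
  obtain ⟨χ, hχ⟩ := hJ.exists_boundedLatticeHom
  have key : ∀ a : P, a ∈ G → χ (OrderDual.ofDual a).1 := fun a ha =>
    (hχ _).2 (Set.disjoint_left.1 hFJ ⟨a, ha, le_rfl⟩)
  refine ⟨χ, key p (Order.mem_idealOfCofinals p 𝒞), fun i => ?_⟩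
  obtain ⟨a, ha, haG⟩ := Order.cofinal_meets_idealOfCofinals p 𝒞 i
  exact ⟨_, ha, key a haG⟩

/-! ### Henkin construction of countable pre-models. -/

namespace CylindricAlgebra

section Henkin

variable {I : Type v} {B : Type u} [BooleanAlgebra B] (𝔅 : CylindricAlgebra I B)

/-- Every element has a finite dimension set. -/
def IsLocallyFinite : Prop := ∀ x, {κ | 𝔅.c κ x ≠ x}.Finite

variable {𝔅}

/-- Ultrafilters with witnesses from `range φ`, avoiding given finite sets, for countably many
cylindrifications. -/
theorem IsLocallyFinite.exists_henkin (hfin : 𝔅.IsLocallyFinite) {φ : ℕ → I}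
    (hφ : Function.Injective φ) {ι : Type*} [Countable ι] (κ : ι → I) (y : ι → B)
    (E : ι → Finset I) {b : B} (hb : b ≠ ⊥) :
    ∃ χ : BoundedLatticeHom B Prop, χ b ∧ ∀ i, χ (𝔅.c (κ i) (y i)) →
      ∃ m, φ m ≠ κ i ∧ φ m ∉ E i ∧ χ (𝔅.subst (κ i) (φ m) (y i)) := by
  obtain ⟨χ, hχb, hχ⟩ := exists_boundedLatticeHom_of_dense
    (fun i => {a | a ≤ (𝔅.c (κ i) (y i))ᶜ ∨
      ∃ m, φ m ≠ κ i ∧ φ m ∉ E i ∧ a ≤ 𝔅.subst (κ i) (φ m) (y i)}) (by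
    intro i b hb
    by_cases h : b ⊓ 𝔅.c (κ i) (y i) = ⊥
    · refine ⟨b, Or.inl ?_, hb, le_rfl⟩
      rwa [le_compl_iff_disjoint_right, disjoint_iff]
    · have hinf := Set.infinite_range_of_injective hφ
      -- With `φ m` fresh for `b` and `y i`, applying `c (φ m)` to `b ⊓ subst (κ i) (φ m) (y i)`
      -- yields `b ⊓ c (κ i) (y i)`, which is nonzero.
      obtain ⟨-, ⟨m, rfl⟩, hm⟩ := hinf.exists_notMem_finite
        ((((hfin b).union (hfin (y i))).union (E i).finite_toSet).union (Set.finite_singleton (κ i)))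
      simp only [Set.mem_union, Set.mem_ofPred_eq, not_or, not_not, Finset.mem_coe,
        Set.mem_singleton_iff] at hm
      obtain ⟨⟨⟨h₁, h₂⟩, h₃⟩, h₄⟩ := hm
      refine ⟨b ⊓ 𝔅.subst (κ i) (φ m) (y i), Or.inr ⟨m, h₄, h₃, inf_le_right⟩, fun h₀ => h ?_,
        inf_le_left⟩
      rw [← 𝔅.c_subst_of_c_eq (Ne.symm h₄) h₂, ← 𝔅.c_inf_left h₁, h₀, 𝔅.c_bot]) hb
  refine ⟨χ, hχb, fun i hi => ?_⟩
  obtain ⟨a, ha | ⟨m, h₁, h₂, ha⟩, hχa⟩ := hχ i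
  · have := OrderHomClass.mono χ ha hχa
    rw [map_compl'] at this
    exact absurd hi this
  · exact ⟨m, h₁, h₂, OrderHomClass.mono χ ha hχa⟩

/-- A model of a locally finite cylindric algebra on the natural numbers: equality is interpreted
by an equivalence relation. Cylindrifications are not required to be respected. -/
structure PreModel (𝔅 : CylindricAlgebra I B) where
  eqv : ℕ → ℕ → Prop
  equivalence : Equivalence eqv
  sat : B → Set (I → ℕ)
  sat_inf : ∀ x y, sat (x ⊓ y) = sat x ∩ sat y
  sat_compl : ∀ x, sat xᶜ = (sat x)ᶜ
  sat_d : ∀ κ l s, s ∈ sat (𝔅.d κ l) ↔ eqv (s κ) (s l)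
  sat_congr : ∀ x s t, (∀ κ, 𝔅.c κ x ≠ x → eqv (s κ) (t κ)) → s ∈ sat x → t ∈ sat x

open Classical in
/-- The pre-model respects the cylindrification `c_κ x`. -/
def PreModel.Respects (𝔐 : 𝔅.PreModel) (κ : I) (x : B) : Prop :=
  ∀ s, s ∈ 𝔐.sat (𝔅.c κ x) ↔ ∃ n, Function.update s κ n ∈ 𝔐.sat x

variable (𝔅)

/-- The map `f` and the finite set `D` compute the truth value of `x` under the assignment `s`. -/
structure Computes (χ : BoundedLatticeHom B Prop) (φ : ℕ → I) (x : B) (s : I → ℕ) (D : Finset I)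
    (f : I → ℕ) : Prop where
  c_eq : ∀ κ ∉ D, 𝔅.c κ x = x
  notMem : ∀ κ ∈ D, (φ ∘ f) κ ∉ D
  d : ∀ κ ∈ D, χ (𝔅.d (φ (f κ)) (φ (s κ)))

/-- Satisfaction of `x` under `s` according to the ultrafilter `χ`. -/
def satOf (χ : BoundedLatticeHom B Prop) (φ : ℕ → I) (x : B) : Set (I → ℕ) :=
  {s | ∃ D f, 𝔅.Computes χ φ x s D f ∧ χ (𝔅.substs D (φ ∘ f) x)}

variable {𝔅}
variable {χ : BoundedLatticeHom B Prop} {φ : ℕ → I}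

theorem apply_d_symm {κ l : I} (h : χ (𝔅.d κ l)) : χ (𝔅.d l κ) := by rwa [𝔅.d_symm]

theorem apply_d_trans {κ l m : I} (h : χ (𝔅.d κ l)) (h' : χ (𝔅.d l m)) : χ (𝔅.d κ m) := by
  have := OrderHomClass.mono χ (𝔅.d_trans κ l m)
  rw [map_inf] at this
  exact this ⟨h, h'⟩

theorem apply_d_self (κ : I) : χ (𝔅.d κ κ) := by
  rw [𝔅.d_self, map_top]
  trivial

/-- Both substitutions reduce to the coordinates on which `x` depends. There `f` and `f'` name
`χ`-equal variables, each being `χ`-equal to the one named by `s`. -/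
theorem Computes.iff {x : B} {s : I → ℕ} {D D' : Finset I} {f f' : I → ℕ}
    (h : 𝔅.Computes χ φ x s D f) (h' : 𝔅.Computes χ φ x s D' f') :
    χ (𝔅.substs D (φ ∘ f) x) ↔ χ (𝔅.substs D' (φ ∘ f') x) := by
  classical
  have key : ∀ {D : Finset I} {f : I → ℕ}, 𝔅.Computes χ φ x s D f →
      𝔅.substs D (φ ∘ f) x = 𝔅.substs (D.filter fun κ => 𝔅.c κ x ≠ x) (φ ∘ f) x := by
    intro D f h
    have hD := Finset.filter_union_filter_not_eq (fun κ => 𝔅.c κ x ≠ x) D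
    conv_lhs => rw [← hD]
    refine 𝔅.substs_union ?_ ?_
    · rw [hD]
      exact h.notMem
    · intro κ hκ
      simpa using (Finset.mem_filter.1 hκ).2
  have hDD' : (D.filter fun κ => 𝔅.c κ x ≠ x) = D'.filter fun κ => 𝔅.c κ x ≠ x := by
    ext κ
    simp only [Finset.mem_filter, and_congr_left_iff]
    exact fun hκ => ⟨fun _ => not_not.1 fun h₁ => hκ (h'.c_eq κ h₁),
      fun _ => not_not.1 fun h₁ => hκ (h.c_eq κ h₁)⟩
  rw [key h, key h', ← hDD']
  refine 𝔅.substs_iff_of_d χ ?_ ?_ ?_ x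
  · exact fun m hm hm' => h.notMem m (Finset.mem_filter.1 hm).1 (Finset.mem_filter.1 hm').1
  · rw [hDD']
    exact fun m hm hm' => h'.notMem m (Finset.mem_filter.1 hm).1 (Finset.mem_filter.1 hm').1
  · intro m hm
    have hm' := hm
    rw [hDD'] at hm'
    exact apply_d_trans (h.d m (Finset.mem_filter.1 hm).1)
      (apply_d_symm (h'.d m (Finset.mem_filter.1 hm').1))

theorem Computes.mem_iff {x : B} {s : I → ℕ} {D : Finset I} {f : I → ℕ}
    (h : 𝔅.Computes χ φ x s D f) : s ∈ 𝔅.satOf χ φ x ↔ χ (𝔅.substs D (φ ∘ f) x) :=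
  ⟨fun ⟨_, _, h₁, h₂⟩ => (h₁.iff h).1 h₂, fun h₁ => ⟨D, f, h, h₁⟩⟩

/-- Every class of `range φ` modulo the equality of `χ` meets the complement of every finite
set. -/
def HasInfiniteClasses (𝔅 : CylindricAlgebra I B) (χ : BoundedLatticeHom B Prop) (φ : ℕ → I) :
    Prop :=
  ∀ (n : ℕ) (E : Finset I), ∃ m, φ m ∉ E ∧ χ (𝔅.d (φ m) (φ n))

theorem HasInfiniteClasses.exists_computes (hχ : HasInfiniteClasses 𝔅 χ φ) (s : I → ℕ)
    (D : Finset I) : ∃ f : I → ℕ, ∀ x, (∀ κ ∉ D, 𝔅.c κ x = x) → 𝔅.Computes χ φ x s D f := by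
  choose f hf using fun κ => hχ (s κ) D
  exact ⟨f, fun x hx => ⟨hx, fun κ _ => (hf κ).1, fun κ _ => (hf κ).2⟩⟩

theorem c_eq_of_notMem_toFinset (hfin : 𝔅.IsLocallyFinite) {x : B} {κ : I}
    (h : κ ∉ (hfin x).toFinset) : 𝔅.c κ x = x := by
  simpa using h

/-- The pre-model given by an ultrafilter with infinite classes. -/
def HasInfiniteClasses.preModel (hχ : HasInfiniteClasses 𝔅 χ φ) (hfin : 𝔅.IsLocallyFinite) :
    𝔅.PreModel where
  eqv m n := χ (𝔅.d (φ m) (φ n))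
  equivalence := ⟨fun _ => apply_d_self _, apply_d_symm, apply_d_trans⟩
  sat := 𝔅.satOf χ φ
  sat_inf x y := by
    classical
    ext s
    obtain ⟨f, hf⟩ := hχ.exists_computes s ((hfin x).toFinset ∪ (hfin y).toFinset)
    have hx := hf x fun κ hκ => c_eq_of_notMem_toFinset hfin fun h =>
      hκ (Finset.mem_union_left _ h)
    have hy := hf y fun κ hκ => c_eq_of_notMem_toFinset hfin fun h =>
      hκ (Finset.mem_union_right _ h)
    have hxy := hf (x ⊓ y) fun κ hκ => 𝔅.c_inf (hx.c_eq κ hκ) (hy.c_eq κ hκ)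
    rw [Set.mem_inter_iff, hx.mem_iff, hy.mem_iff, hxy.mem_iff, 𝔅.substs_inf hx.notMem, map_inf]
    rfl
  sat_compl x := by
    ext s
    obtain ⟨f, hf⟩ := hχ.exists_computes s (hfin x).toFinset
    have hx := hf x fun κ hκ => c_eq_of_notMem_toFinset hfin hκ
    have hx' := hf xᶜ fun κ hκ => 𝔅.c_compl (hx.c_eq κ hκ)
    rw [Set.mem_compl_iff, hx.mem_iff, hx'.mem_iff, 𝔅.substs_compl hx.notMem, map_compl']
    rfl
  sat_d κ l s := by
    classical
    rcases eq_or_ne κ l with rfl | hκl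
    · have : s ∈ 𝔅.satOf χ φ (𝔅.d κ κ) := by
        refine ⟨∅, s, ⟨fun m _ => ?_, by simp, by simp⟩, ?_⟩
        · rw [𝔅.d_self, 𝔅.c_top]
        · rw [𝔅.substs_empty]
          exact apply_d_self _
      exact iff_of_true this (apply_d_self _)
    · obtain ⟨f, hf⟩ := hχ.exists_computes s (insert κ (insert l ∅))
      have h := hf (𝔅.d κ l) fun m hm => by
        simp only [Finset.mem_insert, Finset.notMem_empty, or_false, not_or] at hm
        exact 𝔅.c_d_of_ne hm.1 hm.2
      have hκ := h.notMem κ (by simp)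
      have hl := h.notMem l (by simp)
      have hl' : ∀ m ∈ insert l (∅ : Finset I), (φ ∘ f) m ∉ insert l (∅ : Finset I) := fun m hm h₁ =>
        h.notMem m (Finset.mem_insert_of_mem hm) (Finset.mem_insert_of_mem h₁)
      simp only [Finset.mem_insert, Finset.notMem_empty, or_false, not_or] at hκ hl
      rw [h.mem_iff, 𝔅.substs_insert (by simpa using hκl) h.notMem,
        𝔅.substs_insert (by simp) hl', 𝔅.substs_empty,
        𝔅.subst_d_right (Ne.symm hl.2) hκl.symm, 𝔅.subst_d (Ne.symm hκ.1) (Ne.symm hl.1)]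
      have h₁ := h.d κ (by simp)
      have h₂ := h.d l (by simp)
      exact ⟨fun h₃ => apply_d_trans (apply_d_trans (apply_d_symm h₁) h₃) h₂,
        fun h₃ => apply_d_trans (apply_d_trans h₁ h₃) (apply_d_symm h₂)⟩
  sat_congr x s t hst hs := by
    obtain ⟨f, hf⟩ := hχ.exists_computes s (hfin x).toFinset
    have h := hf x fun κ hκ => c_eq_of_notMem_toFinset hfin hκ
    -- The same `f` serves for `t`, as `s` and `t` are `χ`-equal wherever `x` depends.
    have h' : 𝔅.Computes χ φ x t (hfin x).toFinset f :=
      ⟨h.c_eq, h.notMem, fun κ hκ => apply_d_trans (h.d κ hκ) (hst κ (by simpa using hκ))⟩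
    exact h'.mem_iff.2 (h.mem_iff.1 hs)

-- Put `z = substs D (φ ∘ f) x`. The truth value of `c κ x` at `s` is that of `c κ z`, and the value
-- of `x` at `update s κ n` is that of `subst κ (φ m) z` for any `φ m` outside `insert κ D` that is
-- `χ`-equal to `φ n`. One direction is `hwit`, the other is `subst_le_c`.
open Classical in
theorem HasInfiniteClasses.respects (hχ : HasInfiniteClasses 𝔅 χ φ) (hfin : 𝔅.IsLocallyFinite)
    {κ : I} {x : B} {D : Finset I} (hκ : κ ∉ D) (hD : ∀ m ∉ insert κ D, 𝔅.c m x = x)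
    (hwit : ∀ f : I → ℕ, χ (𝔅.c κ (𝔅.substs D (φ ∘ f) x)) →
      ∃ m, φ m ≠ κ ∧ φ m ∉ D ∧ χ (𝔅.subst κ (φ m) (𝔅.substs D (φ ∘ f) x))) :
    (hχ.preModel hfin).Respects κ x := by
  intro s
  change s ∈ 𝔅.satOf χ φ _ ↔ ∃ n, Function.update s κ n ∈ 𝔅.satOf χ φ x
  obtain ⟨f, hf⟩ := hχ.exists_computes s (insert κ D)
  have h := hf x hD
  have hfD : ∀ m ∈ D, (φ ∘ f) m ∉ D := fun m hm h₁ =>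
    h.notMem m (Finset.mem_insert_of_mem hm) (Finset.mem_insert_of_mem h₁)
  have hfκ : ∀ m ∈ D, κ ≠ (φ ∘ f) m := fun m hm h₁ =>
    h.notMem m (Finset.mem_insert_of_mem hm) (Finset.mem_insert.2 (Or.inl h₁.symm))
  have hc : 𝔅.Computes χ φ (𝔅.c κ x) s D f := by
    refine ⟨fun m hm => ?_, hfD, fun m hm => h.d m (Finset.mem_insert_of_mem hm)⟩
    rcases eq_or_ne m κ with rfl | hmκ
    · exact 𝔅.c_c m x
    · rw [𝔅.c_comm, hD m (by simp [hmκ, hm])]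
  rw [hc.mem_iff, ← 𝔅.c_substs_comm hfD hκ hfκ]
  have hne : ∀ m ∈ D, m ≠ κ := fun m hm h => hκ (h ▸ hm)
  have hupd : ∀ m n, φ m ≠ κ → φ m ∉ D → χ (𝔅.d (φ m) (φ n)) →
      (Function.update s κ n ∈ 𝔅.satOf χ φ x ↔
        χ (𝔅.subst κ (φ m) (𝔅.substs D (φ ∘ f) x))) := by
    intro m n h₁ h₂ h₃
    have h' : 𝔅.Computes χ φ x (Function.update s κ n) (insert κ D) (Function.update f κ m) := by
      refine ⟨hD, fun l hl => ?_, fun l hl => ?_⟩ <;> rcases Finset.mem_insert.1 hl with rfl | hl'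
      · simp [h₁, h₂]
      · rw [Function.comp_apply, Function.update_of_ne (hne l hl')]
        exact h.notMem l hl
      · simpa using h₃
      · rw [Function.update_of_ne (hne l hl'), Function.update_of_ne (hne l hl')]
        exact h.d l hl
    rw [h'.mem_iff, 𝔅.substs_insert hκ h'.notMem, Function.comp_apply, Function.update_self,
      𝔅.substs_congr (g := φ ∘ f)]
    intro l hl
    simp [Function.update_of_ne (hne l hl)]
  constructor
  · intro h₁
    obtain ⟨m, h₂, h₃, h₄⟩ := hwit f h₁
    exact ⟨m, (hupd m m h₂ h₃ (apply_d_self _)).2 h₄⟩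
  · rintro ⟨n, hn⟩
    obtain ⟨m, hm, hmn⟩ := hχ n (insert κ D)
    rw [Finset.mem_insert, not_or] at hm
    exact OrderHomClass.mono χ (𝔅.subst_le_c κ (φ m) _) ((hupd m n hm.1 hm.2 hmn).1 hn)

theorem IsLocallyFinite.exists_preModel [Infinite I] (hfin : 𝔅.IsLocallyFinite)
    (X : Finset (I × B)) {b : B} (hb : b ≠ ⊥) (hdim : ∀ κ, 𝔅.c κ b = b) :
    ∃ 𝔐 : 𝔅.PreModel, (∀ p ∈ X, 𝔐.Respects p.1 p.2) ∧ 𝔐.sat b = Set.univ := by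
  classical
  obtain ⟨φ, hφ⟩ : ∃ φ : ℕ → I, Function.Injective φ := ⟨_, (Infinite.natEmbedding I).injective⟩
  let D : I × B → Finset I := fun p => (hfin p.2).toFinset.erase p.1
  -- Only values on the finite set `D p` matter, so countably many `g` cover all assignments; the
  -- default `0` is immaterial.
  let ext : ∀ p : I × B, (D p → ℕ) → I → ℕ := fun p g κ => if h : κ ∈ D p then g ⟨κ, h⟩ else 0
  let y : (Σ p : X, (D p → ℕ)) → B := fun i => 𝔅.substs (D i.1) (φ ∘ ext i.1 i.2) i.1.1.2
  -- The left summand provides witnesses for the pairs in `X`. The right one makes classes infinite: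
  -- `c (φ (n+1)) (d (φ (n+1)) (φ n)) = ⊤`, and a witness `φ m` for it satisfies `d (φ m) (φ n)`.
  -- Here `n + 1` is just an index other than `n`, and avoided sets are indexed by `Finset ℕ` to
  -- stay countable.
  obtain ⟨χ, hχb, hχ⟩ := hfin.exists_henkin hφ
    (ι := (Σ p : X, (D p → ℕ)) ⊕ (ℕ × Finset ℕ))
    (Sum.elim (fun i => i.1.1.1) (fun i => φ (i.1 + 1)))
    (Sum.elim y (fun i => 𝔅.d (φ (i.1 + 1)) (φ i.1)))
    (Sum.elim (fun i => D i.1) (fun i => i.2.image φ)) hb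
  have hcl : HasInfiniteClasses 𝔅 χ φ := by
    intro n E
    have hne : φ (n + 1) ≠ φ n := fun h => Nat.succ_ne_self n (hφ h)
    obtain ⟨m, h₁, h₂, h₃⟩ := hχ (Sum.inr (n, E.preimage φ hφ.injOn)) (by
      simp only [Sum.elim_inr, 𝔅.c_d hne, map_top]
      trivial)
    simp only [Sum.elim_inr] at h₁ h₂ h₃
    refine ⟨m, fun hm => h₂ ?_, ?_⟩
    · exact Finset.mem_image_of_mem φ (Finset.mem_preimage.2 hm)
    · rwa [𝔅.subst_d (Ne.symm h₁) hne] at h₃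
  refine ⟨hcl.preModel hfin, ?_, ?_⟩
  · intro p hp
    refine hcl.respects hfin (D := D p) (Finset.notMem_erase _ _) ?_ ?_
    · intro m hm
      refine c_eq_of_notMem_toFinset hfin fun h => hm ?_
      by_cases h' : m = p.1
      · simp [h']
      · exact Finset.mem_insert_of_mem (Finset.mem_erase.2 ⟨h', h⟩)
    · intro f hf
      have := hχ (Sum.inl ⟨⟨p, hp⟩, fun κ => f κ⟩)
      simp only [Sum.elim_inl, y] at this
      rw [𝔅.substs_congr (g := φ ∘ f)] at this
      · exact this hf
      · intro κ hκ
        simp [ext, hκ]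
  · refine Set.eq_univ_of_forall fun s => ?_
    refine ⟨∅, s, ⟨fun κ _ => hdim κ, by simp, by simp⟩, ?_⟩
    rwa [𝔅.substs_empty]

end Henkin

end CylindricAlgebra

/-- A map preserving meets and complements is a homomorphism of Boolean algebras. -/
def BoundedLatticeHom.ofInfCompl {B C : Type*} [BooleanAlgebra B] [BooleanAlgebra C] (f : B → C)
    (h_inf : ∀ x y, f (x ⊓ y) = f x ⊓ f y) (h_compl : ∀ x, f xᶜ = (f x)ᶜ) :
    BoundedLatticeHom B C where
  toFun := f
  map_inf' := h_inf
  map_sup' x y := by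
    rw [← compl_inj_iff, ← h_compl, compl_sup, h_inf, h_compl, h_compl, compl_sup]
  map_top' := by
    have h := h_compl (⊤ ⊓ ⊤ᶜ)
    rwa [h_inf, h_compl ⊤, inf_compl_eq_bot, inf_compl_eq_bot, compl_bot, compl_bot] at h
  map_bot' := by
    have h := h_inf ⊤ ⊤ᶜ
    rwa [h_compl, inf_compl_eq_bot, inf_compl_eq_bot] at h

/-- The cylindric set algebra of all subsets of `U^I`. -/
def CylindricSetAlgebra.full (I U : Type*) : CylindricSetAlgebra I U where
  sets := ⊤
  cylindrify_mem _ _ _ := trivial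
  diagonal_mem _ _ := trivial

namespace CylindricAlgebra

/-- Homomorphisms of cylindric algebras. -/
structure IsHom {I B C : Type*} [BooleanAlgebra B] [BooleanAlgebra C] (𝔅 : CylindricAlgebra I B)
    (ℭ : CylindricAlgebra I C) (f : BoundedLatticeHom B C) : Prop where
  map_c : ∀ κ x, f (𝔅.c κ x) = ℭ.c κ (f x)
  map_d : ∀ κ l, f (𝔅.d κ l) = ℭ.d κ l

/-! ### Ultraproducts of pre-models. -/

section Ultraproduct

open Filter

variable {I : Type v} {B : Type u} [BooleanAlgebra B] {𝔅 : CylindricAlgebra I B}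
variable {J : Type*} (𝒰 : Ultrafilter J) (𝔐 : J → 𝔅.PreModel)

/-- Equality in the ultraproduct of pre-models. -/
def ultraSetoid : Setoid (J → ℕ) where
  r f g := ∀ᶠ j in (𝒰 : Filter J), (𝔐 j).eqv (f j) (g j)
  iseqv := by
    refine ⟨fun f => Eventually.of_forall fun j => (𝔐 j).equivalence.refl _, fun h => ?_,
      fun h h' => ?_⟩
    · exact h.mono fun j hj => (𝔐 j).equivalence.symm hj
    · filter_upwards [h, h'] with j hj hj'
      exact (𝔐 j).equivalence.trans hj hj'

/-- The base of the ultraproduct of pre-models. -/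
abbrev UltraBase : Type _ := Quotient (ultraSetoid 𝒰 𝔐)

/-- Satisfaction in the ultraproduct of pre-models. -/
noncomputable def ultraSat (x : B) : Set (I → UltraBase 𝒰 𝔐) :=
  {s | ∀ᶠ j in (𝒰 : Filter J), (fun κ => (s κ).out j) ∈ (𝔐 j).sat x}

variable {𝒰 𝔐}

/-- Local finiteness lets the equivalences at the finitely many relevant coordinates hold
simultaneously on one set of `𝒰`. -/
theorem mem_ultraSat_congr (hfin : 𝔅.IsLocallyFinite) {x : B} {s t : I → J → ℕ}
    (h : ∀ κ, 𝔅.c κ x ≠ x → ∀ᶠ j in (𝒰 : Filter J), (𝔐 j).eqv (s κ j) (t κ j))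
    (hs : ∀ᶠ j in (𝒰 : Filter J), (fun κ => s κ j) ∈ (𝔐 j).sat x) :
    ∀ᶠ j in (𝒰 : Filter J), (fun κ => t κ j) ∈ (𝔐 j).sat x := by
  have h' := (eventually_all_finite (hfin x)).2 h
  filter_upwards [h', hs] with j hj hj'
  exact (𝔐 j).sat_congr x _ _ hj hj'

theorem mk_mem_ultraSat (hfin : 𝔅.IsLocallyFinite) {x : B} {s : I → UltraBase 𝒰 𝔐}
    {t : I → J → ℕ} (hst : ∀ κ, s κ = Quotient.mk _ (t κ)) :
    s ∈ ultraSat 𝒰 𝔐 x ↔ ∀ᶠ j in (𝒰 : Filter J), (fun κ => t κ j) ∈ (𝔐 j).sat x := by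
  have h : ∀ κ, ∀ᶠ j in (𝒰 : Filter J), (𝔐 j).eqv ((s κ).out j) (t κ j) := fun κ => by
    have : ultraSetoid 𝒰 𝔐 (s κ).out (t κ) := Quotient.exact ((Quotient.out_eq _).trans (hst κ))
    exact this
  exact ⟨mem_ultraSat_congr hfin fun κ _ => h κ, mem_ultraSat_congr hfin fun κ _ =>
    (h κ).mono fun j hj => (𝔐 j).equivalence.symm hj⟩

theorem ultraSat_inf (x y : B) :
    ultraSat 𝒰 𝔐 (x ⊓ y) = ultraSat 𝒰 𝔐 x ∩ ultraSat 𝒰 𝔐 y := by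
  ext s
  simp only [ultraSat, Set.mem_ofPred_eq, Set.mem_inter_iff, PreModel.sat_inf, eventually_and]

theorem ultraSat_compl (x : B) : ultraSat 𝒰 𝔐 xᶜ = (ultraSat 𝒰 𝔐 x)ᶜ := by
  ext s
  simp only [ultraSat, Set.mem_ofPred_eq, Set.mem_compl_iff, PreModel.sat_compl,
    Ultrafilter.eventually_not]

theorem ultraSat_d (κ l : I) : ultraSat 𝒰 𝔐 (𝔅.d κ l) = diagonal κ l := by
  ext s
  simp only [ultraSat, Set.mem_ofPred_eq, PreModel.sat_d, diagonal]
  rw [← Quotient.out_equiv_out]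
  rfl

/-- The existential step of Łoś's theorem: witnesses chosen in `𝒰`-almost all factors form one in
the ultraproduct. -/
theorem ultraSat_c (hfin : 𝔅.IsLocallyFinite) {κ : I} {x : B}
    (h : ∀ᶠ j in (𝒰 : Filter J), (𝔐 j).Respects κ x) :
    ultraSat 𝒰 𝔐 (𝔅.c κ x) = cylindrify κ (ultraSat 𝒰 𝔐 x) := by
  classical
  ext s
  have key : ∀ g : J → ℕ, Function.update s κ (Quotient.mk _ g) ∈ ultraSat 𝒰 𝔐 x ↔
      ∀ᶠ j in (𝒰 : Filter J), Function.update (fun l => (s l).out j) κ (g j) ∈ (𝔐 j).sat x := by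
    intro g
    rw [mk_mem_ultraSat hfin (t := Function.update (fun l => (s l).out) κ g)]
    · refine iff_of_eq (congrArg (fun p => ∀ᶠ j in (𝒰 : Filter J), p j) (funext fun j => ?_))
      congr 1
      funext l
      by_cases hl : l = κ
      · subst hl; simp
      · simp [hl]
    · intro l
      by_cases hl : l = κ
      · subst hl; simp
      · simp [hl]
  constructor
  · intro hs
    have h' : ∀ᶠ j in (𝒰 : Filter J), ∃ n,
        Function.update (fun l => (s l).out j) κ n ∈ (𝔐 j).sat x := by
      filter_upwards [h, hs] with j hj hj'
      convert (hj _).1 hj'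
    obtain ⟨g, hg⟩ := h'.choice
    refine ⟨Quotient.mk _ g, ?_⟩
    convert (key g).2 hg
  · rintro ⟨a, ha⟩
    have ha' : Function.update s κ (Quotient.mk _ a.out) ∈ ultraSat 𝒰 𝔐 x := by
      rw [Quotient.out_eq]
      convert ha
    rw [key] at ha'
    change ∀ᶠ j in (𝒰 : Filter J), _
    filter_upwards [h, ha'] with j hj hj'
    refine (hj _).2 ⟨a.out j, ?_⟩
    convert hj'

theorem ultraSat_dependsOn (x : B) : SetDependsOn {κ | 𝔅.c κ x ≠ x} (ultraSat 𝒰 𝔐 x) := by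
  have key : ∀ s t : I → UltraBase 𝒰 𝔐, (∀ κ ∈ {κ | 𝔅.c κ x ≠ x}, s κ = t κ) →
      s ∈ ultraSat 𝒰 𝔐 x → t ∈ ultraSat 𝒰 𝔐 x := by
    intro s t hst hs
    refine Eventually.mono hs fun j hj => (𝔐 j).sat_congr x _ _ (fun κ hκ => ?_) hj
    rw [hst κ hκ]
    exact (𝔐 j).equivalence.refl _
  exact fun s t hst => ⟨key s t hst, key t s fun κ hκ => (hst κ hκ).symm⟩

end Ultraproduct

/-! ### Representation of locally finite cylindric algebras. -/

section Representation

open Filter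

variable {I : Type v} {B : Type u} [BooleanAlgebra B] {𝔅 : CylindricAlgebra I B}

/-- The existential closure of `b` over `D`. The last clause carries `f a ≠ ⊥` back to `f b ≠ ⊥`. -/
theorem exists_le_of_finset (D : Finset I) (b : B) :
    ∃ a, b ≤ a ∧ (∀ κ ∈ D, 𝔅.c κ a = a) ∧ (∀ κ, 𝔅.c κ b = b → 𝔅.c κ a = a) ∧
      ∀ (C : Type w) [BooleanAlgebra C] (ℭ : CylindricAlgebra I C) (f : BoundedLatticeHom B C),
        𝔅.IsHom ℭ f → f b = ⊥ → f a = ⊥ := by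
  classical
  induction D using Finset.induction_on with
  | empty => exact ⟨b, le_rfl, by simp, fun _ h => h, fun _ _ _ _ _ h => h⟩
  | insert κ D _ ih =>
    obtain ⟨a, hba, ha, ha', haf⟩ := ih
    have hc : ∀ m, 𝔅.c m a = a → 𝔅.c m (𝔅.c κ a) = 𝔅.c κ a := fun m hm => by
      rw [𝔅.c_comm, hm]
    refine ⟨𝔅.c κ a, hba.trans (𝔅.le_c κ a), fun m hm => ?_, fun m hm => hc m (ha' m hm),
      fun C _ ℭ f hf h => ?_⟩
    · rcases Finset.mem_insert.1 hm with rfl | hm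
      · exact 𝔅.c_c m a
      · exact hc m (ha m hm)
    · rw [hf.map_c, haf C ℭ f hf h, ℭ.c_bot]

/-- Locally finite cylindric algebras of infinite dimension are representable: nonzero elements
are separated from zero by homomorphisms to full set algebras with finitely dependent values. -/
theorem IsLocallyFinite.exists_isHom_full [Infinite I] (hfin : 𝔅.IsLocallyFinite) {b : B}
    (hb : b ≠ ⊥) :
    ∃ (U : Type (max u v))
      (f : BoundedLatticeHom B (CylindricSetAlgebra.full I U).sets),
      𝔅.IsHom (CylindricSetAlgebra.full I U).toCylindricAlgebra f ∧
        (∀ x, SetDependsOn {κ | 𝔅.c κ x ≠ x} (f x).1) ∧ f b ≠ ⊥ := by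
  classical
  obtain ⟨a, hba, ha, ha', haf⟩ :=
    exists_le_of_finset.{u, v, max u v} (𝔅 := 𝔅) (hfin b).toFinset b
  have ha₀ : a ≠ ⊥ := fun h => hb (le_bot_iff.1 (h ▸ hba))
  have hdim : ∀ κ, 𝔅.c κ a = a := fun κ => by
    by_cases h : 𝔅.c κ b = b
    · exact ha' κ h
    · exact ha κ (by simpa using h)
  choose 𝔐 h𝔐 h𝔐a using fun X : Finset (I × B) => hfin.exists_preModel X ha₀ hdim
  -- Refining `atTop`, it contains the cone of all `X` above any given pair, so each
  -- cylindrification is respected almost everywhere.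
  let 𝒰 : Ultrafilter (Finset (I × B)) := Ultrafilter.of atTop
  have hresp : ∀ κ x, ∀ᶠ X in (𝒰 : Filter (Finset (I × B))), (𝔐 X).Respects κ x := fun κ x => by
    refine Ultrafilter.of_le atTop ?_
    filter_upwards [eventually_ge_atTop {(κ, x)}] with X hX
    exact h𝔐 X (κ, x) (hX (Finset.mem_singleton_self _))
  let f : BoundedLatticeHom B (CylindricSetAlgebra.full I (UltraBase 𝒰 𝔐)).sets :=
    BoundedLatticeHom.ofInfCompl (fun x => ⟨ultraSat 𝒰 𝔐 x, trivial⟩)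
      (fun x y => Subtype.ext (ultraSat_inf x y)) fun x => Subtype.ext (ultraSat_compl x)
  have hf : 𝔅.IsHom (CylindricSetAlgebra.full I (UltraBase 𝒰 𝔐)).toCylindricAlgebra f :=
    ⟨fun κ x => Subtype.ext (ultraSat_c hfin (hresp κ x)),
      fun κ l => Subtype.ext (ultraSat_d κ l)⟩
  refine ⟨UltraBase 𝒰 𝔐, f, hf, ultraSat_dependsOn, fun h => ?_⟩
  have h' : ultraSat 𝒰 𝔐 a = ∅ := congrArg Subtype.val (haf _ _ f hf h)
  have hmem : (fun _ => Quotient.mk _ fun _ => 0) ∈ ultraSat 𝒰 𝔐 a :=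
    Eventually.of_forall fun X => by simp [h𝔐a]
  rw [h'] at hmem
  exact hmem

end Representation

end CylindricAlgebra

/-! ### Homomorphisms of algebras -/

namespace MCylOps

variable {M I A B C : Type*} {𝔄 : MCylOps M I A} {𝔅 : MCylOps M I B} {ℭ : MCylOps M I C}

theorem IsHom.comp {f : A → B} {g : B → C} (hg : IsHom 𝔅 ℭ g) (hf : IsHom 𝔄 𝔅 f) :
    IsHom 𝔄 ℭ (g ∘ f) where
  map_add a b := by simp only [Function.comp_apply, hf.map_add, hg.map_add]
  map_mul a b := by simp only [Function.comp_apply, hf.map_mul, hg.map_mul]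
  map_neg a := by simp only [Function.comp_apply, hf.map_neg, hg.map_neg]
  map_u p := by simp only [Function.comp_apply, hf.map_u, hg.map_u]
  map_c κ a := by simp only [Function.comp_apply, hf.map_c, hg.map_c]
  map_d κ l := by simp only [Function.comp_apply, hf.map_d, hg.map_d]
  map_δ p a := by simp only [Function.comp_apply, hf.map_δ, hg.map_δ]

/-- The image of a homomorphism. -/
def IsHom.range {f : A → B} (hf : IsHom 𝔄 𝔅 f) : 𝔅.Subalgebra where
  carrier := Set.range f
  add_mem := by
    rintro _ _ ⟨a, rfl⟩ ⟨b, rfl⟩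
    exact ⟨_, hf.map_add a b⟩
  mul_mem := by
    rintro _ _ ⟨a, rfl⟩ ⟨b, rfl⟩
    exact ⟨_, hf.map_mul a b⟩
  neg_mem := by
    rintro _ ⟨a, rfl⟩
    exact ⟨_, hf.map_neg a⟩
  u_mem p := ⟨_, hf.map_u p⟩
  c_mem κ := by
    rintro _ ⟨a, rfl⟩
    exact ⟨_, hf.map_c κ a⟩
  d_mem κ l := ⟨_, hf.map_d κ l⟩
  δ_mem p := by
    rintro _ ⟨a, rfl⟩
    exact ⟨_, hf.map_δ p a⟩

theorem IsHom.isHom_rangeFactorization {f : A → B} (hf : IsHom 𝔄 𝔅 f) :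
    IsHom 𝔄 hf.range.ops (Set.rangeFactorization f) where
  map_add a b := Subtype.ext (hf.map_add a b)
  map_mul a b := Subtype.ext (hf.map_mul a b)
  map_neg a := Subtype.ext (hf.map_neg a)
  map_u p := Subtype.ext (hf.map_u p)
  map_c κ a := Subtype.ext (hf.map_c κ a)
  map_d κ l := Subtype.ext (hf.map_d κ l)
  map_δ p a := Subtype.ext (hf.map_δ p a)

theorem IsHom.pi {J : Type*} {D : J → Type*} {𝔇 : ∀ j, MCylOps M I (D j)} {f : ∀ j, A → D j}
    (hf : ∀ j, IsHom 𝔄 (𝔇 j) (f j)) : IsHom 𝔄 (MCylOps.pi 𝔇) fun a j => f j a where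
  map_add a b := funext fun j => (hf j).map_add a b
  map_mul a b := funext fun j => (hf j).map_mul a b
  map_neg a := funext fun j => (hf j).map_neg a
  map_u p := funext fun j => (hf j).map_u p
  map_c κ a := funext fun j => (hf j).map_c κ a
  map_d κ l := funext fun j => (hf j).map_d κ l
  map_δ p a := funext fun j => (hf j).map_δ p a

theorem IsHom.isIsomorphic_range {f : A → B} (hf : IsHom 𝔄 𝔅 f) (hinj : Function.Injective f) :
    𝔄.IsIsomorphic hf.range.ops :=
  ⟨Equiv.ofBijective (Set.rangeFactorization f)
    ⟨Set.rangeFactorization_injective.2 hinj, Set.rangeFactorization_surjective⟩,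
    hf.isHom_rangeFactorization⟩

end MCylOps

/-! ### Functoriality of `𝔐(𝔅)` -/

section Functoriality

variable {M : Type*} {B C : Type*} [BooleanAlgebra B] [BooleanAlgebra C]

theorem IsMPartition.map [Fintype M] (f : BoundedLatticeHom B C) {x : M → B} (hx : IsMPartition x) :
    IsMPartition fun p => f (x p) := by
  constructor
  · intro p q hpq
    rw [← map_inf, hx.1 p q hpq, map_bot]
  · have := congrArg f hx.2
    rwa [map_finset_sup, map_top] at this

variable (M) in
/-- The map `𝔐(𝔅) → 𝔐(ℭ)` induced by a homomorphism `𝔅 → ℭ`. -/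
def BoundedLatticeHom.mapMPartition [Fintype M] (f : BoundedLatticeHom B C) (x : MPartition M B) :
    MPartition M C :=
  ⟨fun p => f (x.1 p), x.2.map f⟩

theorem map_mTwoValued [DeMorganAlgebra M] (f : BoundedLatticeHom B C) (b : B) (p : M) :
    f (mTwoValued b p) = mTwoValued (f b) p := by
  unfold mTwoValued
  rw [map_sup, apply_ite f, apply_ite f, map_bot, map_compl']

variable [DeMorganAlgebra M] [Fintype M]

theorem map_mSup (f : BoundedLatticeHom B C) (y : M → B) (p : M) :
    f (mSup y p) = mSup (fun q => f (y q)) p := by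
  unfold mSup
  simp only [map_inf, map_compl', map_finset_sup, Function.comp_def, map_finset_inf]

variable (M) in
theorem CylindricAlgebra.IsHom.isHom_mapMPartition {I : Type*} {𝔅 : CylindricAlgebra I B}
    {ℭ : CylindricAlgebra I C} {f : BoundedLatticeHom B C} (hf : 𝔅.IsHom ℭ f) :
    MCylOps.IsHom (𝔅.toM M) (ℭ.toM M) (f.mapMPartition M) where
  map_add x y := Subtype.ext <| funext fun p => by
    change f (mAdd x.1 y.1 p) = mAdd _ _ p
    simp only [mAdd, map_finset_sup, Function.comp_def, map_inf]
    rfl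
  map_mul x y := Subtype.ext <| funext fun p => by
    change f (mMul x.1 y.1 p) = mMul _ _ p
    simp only [mMul, map_finset_sup, Function.comp_def, map_inf]
    rfl
  map_neg x := rfl
  map_u q := Subtype.ext <| funext fun p => by
    change f (mUnit q p) = mUnit q p
    unfold mUnit
    rw [apply_ite f, map_top, map_bot]
  map_c κ x := Subtype.ext <| funext fun p => by
    change f (mSup _ p) = mSup _ p
    simp only [map_mSup, hf.map_c]
    rfl
  map_d κ l := Subtype.ext <| funext fun p => by
    change f (mTwoValued _ p) = mTwoValued _ p
    rw [map_mTwoValued, hf.map_d]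
  map_δ q x := Subtype.ext <| funext fun p => map_mTwoValued f _ p

end Functoriality

/-! ### The crisp part of an `𝔐`-cylindric algebra -/

namespace IsMCylindricAlgebra

variable {M I A : Type*} [DeMorganAlgebra M] [Fintype M] {𝔄 : MCylOps M I A}

/-- The elements `a` with `δ₁ a = a`. -/
def Crisp (_h : IsMCylindricAlgebra 𝔄) : Type _ := {a : A // 𝔄.δ ⊤ a = a}

namespace Crisp

variable {h : IsMCylindricAlgebra 𝔄}

/-- The underlying element of the algebra. -/
def val (a : h.Crisp) : A := a.1

theorem ext {a b : h.Crisp} (hab : a.val = b.val) : a = b := Subtype.ext hab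

theorem δ_top_val (a : h.Crisp) : 𝔄.δ ⊤ a.val = a.val := a.2

theorem val_add_neg (a : h.Crisp) : 𝔄.add a.val (𝔄.neg a.val) = 𝔄.u ⊤ := by
  rw [← a.δ_top_val, h.δ_add_neg]

theorem val_mul_neg (a : h.Crisp) : 𝔄.mul a.val (𝔄.neg a.val) = 𝔄.u ⊥ := by
  rw [← a.δ_top_val, h.δ_mul_neg]

instance : Max h.Crisp where
  max a b := ⟨𝔄.add a.val b.val, by rw [← a.δ_top_val, ← b.δ_top_val, h.δ_one_add]⟩

instance : Min h.Crisp where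
  min a b := ⟨𝔄.mul a.val b.val, by rw [← a.δ_top_val, ← b.δ_top_val, h.δ_one_mul]⟩

instance : Compl h.Crisp where
  compl a := ⟨𝔄.neg a.val, by rw [← a.δ_top_val, h.δ_one_neg]⟩

instance : Top h.Crisp where
  top := ⟨𝔄.u ⊤, h.δ_u_self ⊤⟩

instance : Bot h.Crisp where
  bot := ⟨𝔄.u ⊥, by
    by_cases hM : (⊤ : M) = ⊥
    · rw [← hM, h.δ_u_self]
    · exact h.δ_u_ne ⊤ ⊥ hM⟩

theorem sup_val (a b : h.Crisp) : (a ⊔ b).val = 𝔄.add a.val b.val := rfl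

theorem inf_val (a b : h.Crisp) : (a ⊓ b).val = 𝔄.mul a.val b.val := rfl

theorem compl_val (a : h.Crisp) : aᶜ.val = 𝔄.neg a.val := rfl

theorem top_val : (⊤ : h.Crisp).val = 𝔄.u ⊤ := rfl

theorem bot_val : (⊥ : h.Crisp).val = 𝔄.u ⊥ := rfl

/-- Absorption is not an axiom but follows from complements: `a + 1 = (a + 1)(a + -a) = a + 1·-a =
1`. -/
theorem val_add_one (a : h.Crisp) : 𝔄.add a.val (𝔄.u ⊤) = 𝔄.u ⊤ := by
  rw [← h.mul_u_one (𝔄.add a.val (𝔄.u ⊤))]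
  nth_rw 2 [← a.val_add_neg]
  rw [← h.add_mul, h.mul_comm, h.mul_u_one, a.val_add_neg]

theorem val_mul_zero (a : h.Crisp) : 𝔄.mul a.val (𝔄.u ⊥) = 𝔄.u ⊥ := by
  rw [← h.add_u_zero (𝔄.mul a.val (𝔄.u ⊥))]
  nth_rw 2 [← a.val_mul_neg]
  rw [← h.mul_add, h.add_comm, h.add_u_zero, a.val_mul_neg]

theorem val_add_mul (a b : h.Crisp) : 𝔄.add a.val (𝔄.mul a.val b.val) = a.val := by
  nth_rw 1 [← h.mul_u_one a.val]
  rw [← h.mul_add, h.add_comm, val_add_one, h.mul_u_one]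

theorem val_mul_add (a b : h.Crisp) : 𝔄.mul a.val (𝔄.add a.val b.val) = a.val := by
  nth_rw 1 [← h.add_u_zero a.val]
  rw [← h.add_mul, h.mul_comm, val_mul_zero, h.add_u_zero]

instance : Lattice h.Crisp :=
  Lattice.mk' (fun _ _ => ext (h.add_comm _ _)) (fun _ _ _ => ext (h.add_assoc _ _ _))
    (fun _ _ => ext (h.mul_comm _ _)) (fun _ _ _ => ext (h.mul_assoc _ _ _))
    (fun a b => ext (a.val_add_mul b)) (fun a b => ext (a.val_mul_add b))

instance : BooleanAlgebra h.Crisp where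
  le_sup_inf a b c := le_of_eq (ext (h.add_mul a.val b.val c.val).symm)
  inf_compl_le_bot a := le_of_eq (ext (b := ⊥) a.val_mul_neg)
  top_le_sup_compl a := le_of_eq (ext (a := a ⊔ aᶜ) (b := ⊤) a.val_add_neg).symm
  le_top a := sup_eq_right.1 (ext a.val_add_one)
  bot_le a := sup_eq_left.1 (ext (h.add_u_zero a.val))

theorem sum_val {ι : Type*} (s : Finset ι) (g : ι → h.Crisp) :
    𝔄.sum s (fun i => (g i).val) = (s.sup g).val := by
  rw [Finset.sup_def, ← Finset.coe_toList, Multiset.map_coe, Multiset.sup_coe, MCylOps.sum]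
  induction s.toList with
  | nil => rfl
  | cons i L ih =>
    simp only [List.map_cons, List.foldr_cons, ih, sup_val]

theorem prod_val {ι : Type*} (s : Finset ι) (g : ι → h.Crisp) :
    𝔄.prod s (fun i => (g i).val) = (s.inf g).val := by
  rw [Finset.inf_def, ← Finset.coe_toList, Multiset.map_coe, Multiset.inf_coe, MCylOps.prod]
  induction s.toList with
  | nil => rfl
  | cons i L ih =>
    simp only [List.map_cons, List.foldr_cons, ih, inf_val]

end Crisp

variable (h : IsMCylindricAlgebra 𝔄)

/-- The crisp part as a cylindric algebra. -/
def crisp : CylindricAlgebra I h.Crisp where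
  c κ a := ⟨𝔄.c κ a.val, by rw [← a.δ_top_val, h.δ_one_c]⟩
  d κ l := ⟨𝔄.d κ l, h.δ_one_d κ l⟩
  c_bot κ := Crisp.ext (h.c_u_zero κ)
  le_c κ a := sup_eq_right.1 (Crisp.ext (h.add_c κ a.val))
  c_inf_c κ a b := Crisp.ext (h.c_mul_c κ a.val b.val)
  c_comm κ l a := Crisp.ext (h.c_comm κ l a.val)
  d_self κ := Crisp.ext (h.d_self κ)
  d_eq_c κ l m h₁ h₂ := Crisp.ext (h.d_eq_c κ l m h₁ h₂)
  c_d_inf κ l a hκl := Crisp.ext <| by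
    have := h.c_d_mul κ l a.val hκl
    rwa [a.δ_top_val] at this

theorem crisp_c_val (κ : I) (a : h.Crisp) : (h.crisp.c κ a).val = 𝔄.c κ a.val := rfl

/-- The component `δ_p a` as an element of the crisp part. -/
def component (p : M) (a : A) : h.Crisp := ⟨𝔄.δ p a, h.δ_one_δ p a⟩

theorem component_val (p : M) (a : A) : (h.component p a).val = 𝔄.δ p a := rfl

theorem component_top (a : h.Crisp) : h.component ⊤ a.val = a := Crisp.ext a.δ_top_val

theorem isMPartition_component (a : A) : IsMPartition fun p => h.component p a := by
  refine ⟨fun p q hpq => Crisp.ext (h.δ_mul_δ p q a hpq), Crisp.ext ?_⟩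
  rw [← Crisp.sum_val]
  exact h.sum_δ a

/-- The canonical map to `𝔐(𝔅)`, where `𝔅` is the crisp part. -/
def toMPartition (a : A) : MPartition M h.Crisp := ⟨fun p => h.component p a,
  h.isMPartition_component a⟩

theorem component_crisp (p : M) (b : h.Crisp) : h.component p b.val = mTwoValued b p := by
  -- If `0 = 1` in `M`, then `u ⊥ = u ⊤` and the crisp part is trivial.
  by_cases hM : (⊥ : M) = ⊤
  · have hs : (⊥ : h.Crisp) = ⊤ := Crisp.ext (congrArg 𝔄.u hM)
    have := subsingleton_of_bot_eq_top hs
    exact Subsingleton.elim _ _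
  · unfold mTwoValued
    by_cases h₁ : p = ⊤
    · subst h₁
      rw [if_pos rfl, if_neg (Ne.symm hM), sup_bot_eq, h.component_top]
    · by_cases h₂ : p = ⊥
      · subst h₂
        rw [if_neg h₁, if_pos rfl, bot_sup_eq]
        refine Crisp.ext ?_
        rw [component_val, Crisp.compl_val, ← b.δ_top_val, h.δ_zero_δ]
      · rw [if_neg h₁, if_neg h₂, sup_bot_eq]
        refine Crisp.ext ?_
        rw [component_val, Crisp.bot_val, ← b.δ_top_val, h.δ_δ _ _ _ h₂ h₁]

theorem isHom_toMPartition : MCylOps.IsHom 𝔄 (h.crisp.toM M) h.toMPartition where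
  map_add a b := Subtype.ext <| funext fun p => Crisp.ext <|
    (h.δ_add p a b).trans (Crisp.sum_val _ fun t : M × M => h.component t.1 a ⊓ h.component t.2 b)
  map_mul a b := Subtype.ext <| funext fun p => Crisp.ext <|
    (h.δ_mul p a b).trans (Crisp.sum_val _ fun t : M × M => h.component t.1 a ⊓ h.component t.2 b)
  map_neg a := Subtype.ext <| funext fun p => Crisp.ext (h.δ_neg p a)
  map_u q := Subtype.ext <| funext fun p => Crisp.ext <| by
    change 𝔄.δ p (𝔄.u q) = Crisp.val (mUnit q p)
    unfold mUnit
    split_ifs with hpq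
    · rw [hpq, h.δ_u_self, Crisp.top_val]
    · rw [h.δ_u_ne p q hpq, Crisp.bot_val]
  map_c κ a := Subtype.ext <| funext fun p => Crisp.ext <| by
    change 𝔄.δ p (𝔄.c κ a) = Crisp.val (mSup (fun q => h.crisp.c κ (h.component q a)) p)
    rw [h.δ_c, mSup, Crisp.inf_val, Crisp.compl_val, ← Crisp.sum_val, ← Crisp.sum_val]
    simp only [← Crisp.prod_val, crisp_c_val, component_val]
  map_d κ l := Subtype.ext <| funext fun p => h.component_crisp p (h.crisp.d κ l)
  map_δ q a := Subtype.ext <| funext fun p => h.component_crisp p (h.component q a)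

theorem component_injective {a b : A} (hab : ∀ p, h.component p a = h.component p b) : a = b :=
  h.ext a b fun p => congrArg Crisp.val (hab p)

theorem isLocallyFinite_crisp (hfin : 𝔄.IsLocallyFinite) : h.crisp.IsLocallyFinite := by
  intro a
  refine (hfin a.val).subset fun κ hκ => Set.mem_iUnion.2 ⟨⊤, ?_⟩
  rw [Set.mem_ofPred_eq, a.δ_top_val]
  exact fun h' => hκ (Crisp.ext h')

end IsMCylindricAlgebra

/-! ### Regularity -/

/-- Since `Δ` is finite, `s` can be turned into `t` on `Δ` one coordinate at a time: a change
outside `Γ` does not affect membership, and inside `Γ` there is nothing to change. -/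
theorem SetDependsOn.of_cylindrify_eq {I U : Type*} {X : Set (I → U)} {Δ Γ : Set I}
    (hX : SetDependsOn Δ X) (hΔ : Δ.Finite) (hΓ : ∀ κ ∉ Γ, cylindrify κ X = X) :
    SetDependsOn Γ X := by
  classical
  have step : ∀ κ ∉ Γ, ∀ (r : I → U) (a : U), Function.update r κ a ∈ X ↔ r ∈ X := by
    intro κ hκ r a
    have h : ∀ (r : I → U) (a : U), Function.update r κ a ∈ X → r ∈ X := fun r a hr => by
      rw [← hΓ κ hκ]
      refine ⟨a, ?_⟩
      convert hr
    refine ⟨h r a, fun hr => h _ (r κ) ?_⟩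
    rwa [Function.update_idem, Function.update_eq_self]
  intro s t hst
  have key : ∀ D : Finset I, D.piecewise t s ∈ X ↔ s ∈ X := by
    intro D
    induction D using Finset.induction_on with
    | empty => simp
    | insert κ D hκ ih =>
      rw [Finset.piecewise_insert]
      by_cases hκΓ : κ ∈ Γ
      · have h : D.piecewise t s κ = t κ := by
          rw [Finset.piecewise_eq_of_notMem _ _ _ hκ, hst κ hκΓ]
        rwa [← h, Function.update_eq_self]
      · rwa [step κ hκΓ]
  rw [← key hΔ.toFinset]
  refine hX _ _ fun κ hκ => ?_
  rw [Finset.piecewise_eq_of_mem _ _ _ (hΔ.mem_toFinset.2 hκ)]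

namespace IsMCylindricAlgebra

variable {M I A U : Type*} [DeMorganAlgebra M] [Fintype M] {𝔄 : MCylOps M I A}
  (h : IsMCylindricAlgebra 𝔄) {f : BoundedLatticeHom h.Crisp (CylindricSetAlgebra.full I U).sets}

theorem isHom_full (hf : h.crisp.IsHom (CylindricSetAlgebra.full I U).toCylindricAlgebra f) :
    MCylOps.IsHom 𝔄 ((CylindricSetAlgebra.full I U).toCylindricAlgebra.toM M)
    (f.mapMPartition M ∘ h.toMPartition) :=
  (hf.isHom_mapMPartition M).comp h.isHom_toMPartition

/-- The `𝔐`-cylindric set algebra given by a homomorphism of the crisp part to a full set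
algebra. -/
noncomputable def image (hf : h.crisp.IsHom (CylindricSetAlgebra.full I U).toCylindricAlgebra f) :
    MCylindricSetAlgebra M I U where
  base := CylindricSetAlgebra.full I U
  sub := (h.isHom_full hf).range

/-- The dimension set of an image may be smaller than that of its preimage, so `hdep` alone does not
suffice; it supplies the finite support required by `of_cylindrify_eq`. -/
theorem isRegular_image
    (hf : h.crisp.IsHom (CylindricSetAlgebra.full I U).toCylindricAlgebra f) (hfin : 𝔄.IsLocallyFinite)
    (hdep : ∀ x, SetDependsOn {κ | h.crisp.c κ x ≠ x} (f x).1) : (h.image hf).IsRegular := by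
  rintro ⟨-, a, rfl⟩ p
  refine (hdep (h.component p a)).of_cylindrify_eq (h.isLocallyFinite_crisp hfin _) fun κ hκ => ?_
  simp only [MCylOps.dim, Set.mem_iUnion, Set.mem_ofPred_eq, not_exists, not_not] at hκ
  have hκp := congrArg Subtype.val (hκ p)
  have hhom := h.isHom_full hf
  change ((CylindricSetAlgebra.full I U).toCylindricAlgebra.toM M).c κ
    (((CylindricSetAlgebra.full I U).toCylindricAlgebra.toM M).δ p _) =
    ((CylindricSetAlgebra.full I U).toCylindricAlgebra.toM M).δ p _ at hκp
  rw [← hhom.map_δ, ← hhom.map_c] at hκp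
  -- The component at `⊤` of a crisp element is the element itself, so this equation says that `c κ`
  -- fixes the `p`-th component.
  have htop : f (h.component ⊤ (h.crisp.c κ (h.component p a)).val) =
      f (h.component ⊤ (h.component p a).val) := congrFun (congrArg Subtype.val hκp) ⊤
  rw [h.component_top, h.component_top, hf.map_c] at htop
  exact congrArg Subtype.val htop

end IsMCylindricAlgebra

/-- Locally finite `𝔐`-cylindric algebras of infinite dimension are isomorphic to subdirect
products of regular `𝔐`-cylindric set algebras. -/
theorem IsMCylindricAlgebra.exists_regular_subdirect {M : Type w} [DeMorganAlgebra M] [Fintype M]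
    {I : Type v} [Infinite I] {A : Type u} {𝔄 : MCylOps M I A} (h : IsMCylindricAlgebra 𝔄)
    (hfin : 𝔄.IsLocallyFinite) :
    ∃ (J : Type (max u v)) (U : J → Type (max u v)) (𝔖 : ∀ j, MCylindricSetAlgebra M I (U j)),
      (∀ j, (𝔖 j).IsRegular) ∧ ∃ S : (MCylOps.pi fun j => (𝔖 j).ops).Subalgebra,
        S.IsSubdirect ∧ 𝔄.IsIsomorphic S.ops := by
  choose U f hf hdep hne using fun b : ULift.{v} {b : h.Crisp // b ≠ ⊥} =>
    (h.isLocallyFinite_crisp hfin).exists_isHom_full b.down.2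
  have hhom : ∀ j, MCylOps.IsHom 𝔄 (h.image (hf j)).ops
      (Set.rangeFactorization ((f j).mapMPartition M ∘ h.toMPartition)) := fun j =>
    (h.isHom_full (hf j)).isHom_rangeFactorization
  refine ⟨_, U, fun j => h.image (hf j), fun j => h.isRegular_image (hf j) hfin (hdep j),
    (MCylOps.IsHom.pi hhom).range, ?_, (MCylOps.IsHom.pi hhom).isIsomorphic_range ?_⟩
  · rintro j ⟨-, a, rfl⟩
    exact ⟨_, ⟨a, rfl⟩, rfl⟩
  · intro a b hab
    refine h.component_injective fun p => ?_
    by_contra hp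
    -- If some components differ, their symmetric difference is nonzero, and the factor indexed by
    -- it tells them apart.
    let j : ULift.{v} {b : h.Crisp // b ≠ ⊥} :=
      ⟨⟨symmDiff (h.component p a) (h.component p b), mt symmDiff_eq_bot.1 hp⟩⟩
    have hj : f j (h.component p a) = f j (h.component p b) :=
      congrFun (congrArg Subtype.val (congrArg Subtype.val (congrFun hab j))) p
    refine hne j ?_
    change f j (symmDiff (h.component p a) (h.component p b)) = ⊥
    rw [map_symmDiff', hj, symmDiff_self]

theorem mainTheorem1 {M : Type w} [DeMorganAlgebra M] [Fintype M] (α : Ordinal.{v})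
    (hα : Ordinal.omega0 ≤ α) {A : Type u} (𝔄 : MCylOps M α.ToType A)
    (h𝔄 : IsMCylindricAlgebra 𝔄) (hfin : 𝔄.IsLocallyFinite) :
    𝔄.IsRegularlyRepresentable ∧ 𝔄.IsRepresentable := by
  have : Infinite α.ToType := by
    rw [Cardinal.infinite_iff, Cardinal.mk_toType, Ordinal.aleph0_le_card]
    exact hα
  obtain ⟨J, U, 𝔖, hreg, S, hsub, hiso⟩ := h𝔄.exists_regular_subdirect hfin
  exact ⟨⟨J, U, 𝔖, hreg, S, hiso⟩, ⟨J, U, 𝔖, S, hsub, hiso⟩⟩
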